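/- **Language.** Let $V=\{x_0,x_1,\dots\}$ be propositional variables and $C$ a set of propositional constants of arbitrary cardinality with $\bot,\top\in C$, $\bot\ne\top$. $Fm(C)$ is the set of formulas built from $V\cup C$ with $\neg,\square,\to,\vee,\wedge,\equiv$ and $\forall x$, where $\forall x\varphi$ is a formula only if $x$ is free in $\varphi$ ($x\in fvar(\varphi)$). $\varphi[x:=\psi]$ is capture-avoiding substitution, in which a quantifier $\forall x$ in $\forall x\varphi$ is renamed to $\forall y$, with $y$ the least variable greater than all variables free in the formulas substituted for the free variables of $\forall x\varphi$; $=_\alpha$ is equality up to names of bound variables. **Systems.** The axioms of $S3^\forall_\equiv$ form the smallest set that contains all formulas (i) substitution-instances of propositional tautologies; (ii) $\square\varphi\to\varphi$; (iii) $\square(\varphi\to\psi)\to(\square\varphi\to\square\psi)$; (iv) $\square(\varphi\to\psi)\to\square(\square\varphi\to\square\psi)$; (v) $\varphi\equiv\psi$ if $\varphi=_\alpha\psi$; (vi) $(\varphi\equiv\psi)\to(\varphi\to\psi)$; (vii) $(\psi\equiv\psi')\to(\varphi[x:=\psi]\equiv\varphi[x:=\psi'])$ if $x\in fvar(\varphi)$;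 (viii) $\forall x(\varphi\equiv\psi)\to(\forall x\varphi\equiv\forall x\psi)$; (ix) $\forall x\varphi\to\varphi[x:=\psi]$; (x) $\forall x(\varphi\to\psi)\to(\forall x\varphi\to\forall x\psi)$; (xi) $\forall x(\varphi\to\psi)\to(\varphi\to\forall x\psi)$ if $x\notin fvar(\varphi)$; (xii) $\square\forall x\varphi\to\forall x\square\varphi$; (xiii) $\forall x\square\varphi\to\square\forall x\varphi$ (Barcan formula), and is closed under passing from an axiom $\varphi$ with $x\in fvar(\varphi)$ to $\forall x\varphi$. $S4^\forall_\equiv$ has the additional scheme $\square\varphi\to\square\square\varphi$, and $S5^\forall_\equiv$ moreover the scheme $\neg\square\varphi\to\square\neg\square\varphi$. The rules are Modus Ponens and Axiom Necessitation (from an axiom $\varphi$ infer $\square\varphi$). $\Phi\vdash_m\varphi$ means that there is a derivation of $\varphi$ from $\Phi$ in $Sm^\forall_\equiv$. $\Phi$ is consistent if $\Phi\nvdash_m\bot$, and a Henkin set if it is maximally consistent and, for all $\varphi\in Fm(C)$ and $x\in fvar(\varphi)$, $\Phi\vdash_m\forall x\varphi$ iff $\Phi\vdash_m\varphi[x:=c]$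 for all $c\in C$. **Models.** A propositional domain is a set $M$ with subsets $TRUE,NEC$, elements $f_\bot,f_\top$, unary operations $f_\square,f_\neg$, binary operations $f_\vee,f_\wedge,f_\to,f_\equiv$, a function $f_\forall:M^M\to M$, and $\varGamma:C\to M$ with $\varGamma(\bot)=f_\bot$, $\varGamma(\top)=f_\top$. An assignment $\gamma:V\to M$ extends to $Fm(C)$ by $\varGamma$ and the operations, with $\gamma(\forall x\varphi)=f_\forall(m\mapsto\gamma_x^m(\varphi))$, where $\gamma_x^m$ is $\gamma$ changed to $m$ at $x$. A function $t:M\to M$ is $(\varphi,x,\gamma)$-definable if $x\in fvar(\varphi)$ and $t(m)=\gamma_x^m(\varphi)$ for all $m$, and definable if this holds for some $\varphi,x,\gamma$. Write $a\le b$ for $f_\to(a,b)\in NEC$, and $a\approx b$ for $a\le b$ and $b\le a$. A normal $S3^\forall_\equiv$-model is a propositional domain with $NEC\neq\varnothing$ such that, for all $a,b\in M$: 1. $\le$ is a preorder, $\approx$ is a congruence for $f_\neg,f_\vee,f_\wedge,f_\to$, and the quotient is a Boolean algebra with the induced order and operations; 2. $f_\bot\notin TRUE$, $f_\top\in TRUE$;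 the operations $f_\to,f_\neg,f_\wedge,f_\vee$ act on membership in $TRUE$ classically; $f_\square(a)\in TRUE$ iff $a\in NEC$; $f_\equiv(a,b)\in TRUE$ iff $a=b$; $f_\forall(t)\in TRUE$ for every definable $t$ with image in $TRUE$; 3. $NEC\subseteq TRUE$ is a filter with respect to $\le$ (upward closed, closed under $f_\wedge$, not containing $f_\bot$); 4. (a) $f_\top\le f_\equiv(a,a)$; (b) $f_\equiv(a,b)\le f_\to(a,b)$; (c) $f_\equiv(a,b)\le f_\equiv(t(a),t(b))$ for definable $t$; (d) $f_\square(a)\le a$; (e) $f_\square(f_\to(a,b))\le f_\to(f_\square(a),f_\square(b))$; (f) $f_\square(f_\to(a,b))\le f_\square(f_\to(f_\square(a),f_\square(b)))$; (g) $f_\forall(m\mapsto f_\equiv(t_1(m),t_2(m)))\le f_\equiv(f_\forall(t_1),f_\forall(t_2))$ and (i) $f_\forall(m\mapsto f_\to(t_1(m),t_2(m)))\le f_\to(f_\forall(t_1),f_\forall(t_2))$ if $t_1$ is $(\varphi,x,\gamma)$-definable and $t_2$ is $(\psi,x,\gamma)$-definable for some $\varphi,\psi,x,\gamma$; (h) $f_\forall(t)\le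 t(a)$ for definable $t$; (j) $f_\forall(m\mapsto f_\to(b,t'(m)))\le f_\to(b,f_\forall(t'))$ if $t'$ is $(\psi,x,\gamma)$-definable and $b=\gamma(\varphi)$ for some $\varphi,\psi,x,\gamma$ with $x\notin fvar(\varphi)$; (k) $f_\square(f_\forall(t))\approx f_\forall(m\mapsto f_\square(t(m)))$ for definable $t$; (l) $f_\forall(t)\in NEC$ for definable $t$ with image in $NEC$. A (normal) $S4^\forall_\equiv$-model satisfies in addition $f_\square(a)\le f_\square(f_\square(a))$, and an $S5^\forall_\equiv$-model moreover $f_\neg(f_\square(a))\le f_\square(f_\neg(f_\square(a)))$, for all $a$. $(\mathcal M,\gamma)\vDash\varphi$ means $\gamma(\varphi)\in TRUE$; $\Phi\Vdash_m\varphi$ means that every normal $Sm^\forall_\equiv$-model with every assignment that satisfies all of $\Phi$ satisfies $\varphi$. **Theorem.** Let $m\in\{3,4,5\}$. (1) Every Henkin set has a normal $Sm^\forall_\equiv$-model (is satisfied in one under some assignment). (2) Every consistent $\Phi\subseteq Fm(C)$ has a normal $Sm^\forall_\equiv$-model. (3) For all $\Phi\cup\{\varphi\}\subseteq Fm(C)$: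 $\Phi\Vdash_m\varphi\iff\Phi\vdash_m\varphi$. -/

import Mathlib

universe u v w

namespace NFL

/-! ## Formulas

Variables are natural numbers. The set of constants of the language is `{⊥, ⊤} ∪ K`, where `K` is
an arbitrary type of further constants. -/

/-- Expressions, without the restriction on vacuous quantification. -/
inductive PreFm (K : Type u) : Type u
  | var : ℕ → PreFm K
  | const : K → PreFm K
  | bot : PreFm K
  | top : PreFm K
  | neg : PreFm K → PreFm K
  | box : PreFm K → PreFm K
  | imp : PreFm K → PreFm K → PreFm K
  | or : PreFm K → PreFm K → PreFm K
  | and : PreFm K → PreFm K → PreFm K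
  | eqv : PreFm K → PreFm K → PreFm K
  | all : ℕ → PreFm K → PreFm K

namespace PreFm

variable {K : Type u}

/-- The set of free variables. -/
def fvar : PreFm K → Finset ℕ
  | var x => {x}
  | const _ => ∅
  | bot => ∅
  | top => ∅
  | neg φ => fvar φ
  | box φ => fvar φ
  | imp φ ψ => fvar φ ∪ fvar ψ
  | or φ ψ => fvar φ ∪ fvar ψ
  | and φ ψ => fvar φ ∪ fvar ψ
  | eqv φ ψ => fvar φ ∪ fvar ψ
  | all x φ => (fvar φ).erase x

/-- An expression is a formula if there is no vacuous quantification in it. -/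
def WF : PreFm K → Prop
  | var _ => True
  | const _ => True
  | bot => True
  | top => True
  | neg φ => WF φ
  | box φ => WF φ
  | imp φ ψ => WF φ ∧ WF ψ
  | or φ ψ => WF φ ∧ WF ψ
  | and φ ψ => WF φ ∧ WF ψ
  | eqv φ ψ => WF φ ∧ WF ψ
  | all x φ => x ∈ fvar φ ∧ WF φ

/-- The variable forced by the substitution `σ` with respect to `χ`: the least variable greater
than all free variables of all `σ u`, where `u` is free in `χ`. -/
def forced (σ : ℕ → PreFm K) (χ : PreFm K) : ℕ :=
  ((fvar χ).biUnion fun u => fvar (σ u)).sup fun z => z + 1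

/-- Capture-avoiding simultaneous substitution for variables (constants are left fixed). -/
def subst : PreFm K → (ℕ → PreFm K) → PreFm K
  | var x, σ => σ x
  | const c, _ => const c
  | bot, _ => bot
  | top, _ => top
  | neg φ, σ => neg (subst φ σ)
  | box φ, σ => box (subst φ σ)
  | imp φ ψ, σ => imp (subst φ σ) (subst ψ σ)
  | or φ ψ, σ => or (subst φ σ) (subst ψ σ)
  | and φ ψ, σ => and (subst φ σ) (subst ψ σ)
  | eqv φ ψ, σ => eqv (subst φ σ) (subst ψ σ)
  | all x φ, σ =>
      all (forced σ (all x φ)) (subst φ (Function.update σ x (var (forced σ (all x φ)))))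

theorem lt_forced {σ : ℕ → PreFm K} {χ : PreFm K} {u z : ℕ} (hu : u ∈ fvar χ)
    (hz : z ∈ fvar (σ u)) : z < forced σ χ := by
  have h : z ∈ (fvar χ).biUnion fun u => fvar (σ u) := Finset.mem_biUnion.2 ⟨u, hu, hz⟩
  exact Nat.lt_of_succ_le (Finset.le_sup (f := fun z : ℕ => z + 1) h)

theorem mem_fvar_subst (φ : PreFm K) : ∀ (σ : ℕ → PreFm K) {u z : ℕ}, u ∈ fvar φ →
    z ∈ fvar (σ u) → z ∈ fvar (subst φ σ) := by
  induction φ with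
  | var x => intro σ u z hu hz; simp only [fvar, Finset.mem_singleton] at hu; subst hu; exact hz
  | const c => intro σ u z hu; simp [fvar] at hu
  | bot => intro σ u z hu; simp [fvar] at hu
  | top => intro σ u z hu; simp [fvar] at hu
  | neg φ ih => intro σ u z hu hz; exact ih σ hu hz
  | box φ ih => intro σ u z hu hz; exact ih σ hu hz
  | imp φ ψ ih1 ih2 | or φ ψ ih1 ih2 | and φ ψ ih1 ih2 | eqv φ ψ ih1 ih2 =>
    intro σ u z hu hz
    simp only [fvar, subst, Finset.mem_union] at hu ⊢
    exact hu.imp (fun h => ih1 σ h hz) (fun h => ih2 σ h hz)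
  | all x φ ih =>
    intro σ u z hu hz
    have hlt := lt_forced hu hz
    have hu' := Finset.mem_erase.1 hu
    refine Finset.mem_erase.2 ⟨hlt.ne, ih _ hu'.2 ?_⟩
    rwa [Function.update_of_ne hu'.1]

theorem WF.subst {φ : PreFm K} : φ.WF → ∀ {σ : ℕ → PreFm K}, (∀ x, (σ x).WF) →
    (φ.subst σ).WF := by
  induction φ with
  | var x => intro _ σ hσ; exact hσ x
  | const c => intro _ _ _; trivial
  | bot => intro _ _ _; trivial
  | top => intro _ _ _; trivial
  | neg φ ih => intro h σ hσ; exact ih h hσ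
  | box φ ih => intro h σ hσ; exact ih h hσ
  | imp φ ψ ih1 ih2 | or φ ψ ih1 ih2 | and φ ψ ih1 ih2 | eqv φ ψ ih1 ih2 =>
    intro h σ hσ; exact ⟨ih1 h.1 hσ, ih2 h.2 hσ⟩
  | all x φ ih =>
    intro h σ hσ
    refine ⟨mem_fvar_subst φ _ h.1 ?_, ih h.2 ?_⟩
    · simp [fvar]
    · intro z
      by_cases hz : z = x
      · subst hz; simp [WF]
      · rw [Function.update_of_ne hz]; exact hσ z

end PreFm

/-- The set of formulas over the constants `{⊥, ⊤} ∪ K`. -/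
def Fm (K : Type u) : Type u := {φ : PreFm K // φ.WF}

namespace Fm

variable {K : Type u}

/-- The free variables of a formula. -/
def fvar (φ : Fm K) : Finset ℕ := φ.1.fvar

def var (x : ℕ) : Fm K := ⟨.var x, trivial⟩
def const (c : K) : Fm K := ⟨.const c, trivial⟩
def bot : Fm K := ⟨.bot, trivial⟩
def top : Fm K := ⟨.top, trivial⟩
def neg (φ : Fm K) : Fm K := ⟨.neg φ.1, φ.2⟩
def box (φ : Fm K) : Fm K := ⟨.box φ.1, φ.2⟩
def imp (φ ψ : Fm K) : Fm K := ⟨.imp φ.1 ψ.1, φ.2, ψ.2⟩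
def or (φ ψ : Fm K) : Fm K := ⟨.or φ.1 ψ.1, φ.2, ψ.2⟩
def and (φ ψ : Fm K) : Fm K := ⟨.and φ.1 ψ.1, φ.2, ψ.2⟩
def eqv (φ ψ : Fm K) : Fm K := ⟨.eqv φ.1 ψ.1, φ.2, ψ.2⟩
/-- `∀ x φ`, a formula only if `x` is free in `φ`. -/
def all (x : ℕ) (φ : Fm K) (h : x ∈ φ.fvar) : Fm K := ⟨.all x φ.1, h, φ.2⟩

/-- `φ[σ]` -/
def subst (φ : Fm K) (σ : ℕ → Fm K) : Fm K :=
  ⟨φ.1.subst fun x => (σ x).1, φ.2.subst fun x => (σ x).2⟩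

/-- `φ[x := ψ]` -/
def subst₁ (φ : Fm K) (x : ℕ) (ψ : Fm K) : Fm K := φ.subst (Function.update var x ψ)

/-- Alpha-congruence (equality up to the names of bound variables): the least congruence that
identifies `∀ x φ` with `∀ y (φ[x := y])` whenever `y` is not free in `∀ x φ`. -/
inductive Alpha : Fm K → Fm K → Prop
  | rename {x y : ℕ} {φ : Fm K} (hx : x ∈ φ.fvar) (hy : y ∉ (all x φ hx).fvar)
      (hy' : y ∈ (φ.subst₁ x (var y)).fvar) :
      Alpha (all x φ hx) (all y (φ.subst₁ x (var y)) hy')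
  | refl (φ : Fm K) : Alpha φ φ
  | symm {φ ψ : Fm K} : Alpha φ ψ → Alpha ψ φ
  | trans {φ ψ χ : Fm K} : Alpha φ ψ → Alpha ψ χ → Alpha φ χ
  | neg {φ φ' : Fm K} : Alpha φ φ' → Alpha (neg φ) (neg φ')
  | box {φ φ' : Fm K} : Alpha φ φ' → Alpha (box φ) (box φ')
  | imp {φ φ' ψ ψ' : Fm K} : Alpha φ φ' → Alpha ψ ψ' → Alpha (imp φ ψ) (imp φ' ψ')
  | or {φ φ' ψ ψ' : Fm K} : Alpha φ φ' → Alpha ψ ψ' → Alpha (or φ ψ) (or φ' ψ')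
  | and {φ φ' ψ ψ' : Fm K} : Alpha φ φ' → Alpha ψ ψ' → Alpha (and φ ψ) (and φ' ψ')
  | eqv {φ φ' ψ ψ' : Fm K} : Alpha φ φ' → Alpha ψ ψ' → Alpha (eqv φ ψ) (eqv φ' ψ')
  | all {x : ℕ} {φ φ' : Fm K} (hx : x ∈ φ.fvar) (hx' : x ∈ φ'.fvar) :
      Alpha φ φ' → Alpha (all x φ hx) (all x φ' hx')

end Fm

/-! ## Propositional tautologies -/

/-- Formulas of propositional logic. -/
inductive PropFm : Type
  | var : ℕ → PropFm
  | bot : PropFm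
  | top : PropFm
  | neg : PropFm → PropFm
  | imp : PropFm → PropFm → PropFm
  | or : PropFm → PropFm → PropFm
  | and : PropFm → PropFm → PropFm

namespace PropFm

/-- Truth under a classical valuation. -/
def Holds (e : ℕ → Prop) : PropFm → Prop
  | var x => e x
  | bot => False
  | top => True
  | neg φ => ¬ Holds e φ
  | imp φ ψ => Holds e φ → Holds e ψ
  | or φ ψ => Holds e φ ∨ Holds e ψ
  | and φ ψ => Holds e φ ∧ Holds e ψ

def IsTautology (φ : PropFm) : Prop := ∀ e : ℕ → Prop, Holds e φ

/-- The substitution-instance of `φ` in which each variable `x` is replaced by `σ x`. -/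
def inst {K : Type u} (σ : ℕ → Fm K) : PropFm → Fm K
  | var x => σ x
  | bot => Fm.bot
  | top => Fm.top
  | neg φ => Fm.neg (inst σ φ)
  | imp φ ψ => Fm.imp (inst σ φ) (inst σ ψ)
  | or φ ψ => Fm.or (inst σ φ) (inst σ ψ)
  | and φ ψ => Fm.and (inst σ φ) (inst σ ψ)

end PropFm

/-! ## The deductive systems -/

/-- The three systems, extending the Lewis systems S3, S4 and S5. -/
inductive Sys : Type
  | S3 | S4 | S5

/-- Axioms of the system `s`. A hypothesis `x ∈ fvar χ` that serves only to make `∀ x χ` a formula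
is listed for every quantified formula that occurs in the axiom. -/
inductive Ax {K : Type u} (s : Sys) : Fm K → Prop
  | taut {φ : PropFm} (h : φ.IsTautology) (σ : ℕ → Fm K) : Ax s (φ.inst σ)
  | T (φ : Fm K) : Ax s (.imp (.box φ) φ)
  | distr (φ ψ : Fm K) : Ax s (.imp (.box (.imp φ ψ)) (.imp (.box φ) (.box ψ)))
  | distrBox (φ ψ : Fm K) :
      Ax s (.imp (.box (.imp φ ψ)) (.box (.imp (.box φ) (.box ψ))))
  | alpha {φ ψ : Fm K} (h : Fm.Alpha φ ψ) : Ax s (.eqv φ ψ)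
  | eqvImp (φ ψ : Fm K) : Ax s (.imp (.eqv φ ψ) (.imp φ ψ))
  | eqvSubst {x : ℕ} {φ : Fm K} (hx : x ∈ φ.fvar) (ψ ψ' : Fm K) :
      Ax s (.imp (.eqv ψ ψ') (.eqv (φ.subst₁ x ψ) (φ.subst₁ x ψ')))
  | allEqv {x : ℕ} {φ ψ : Fm K} (h : x ∈ (Fm.eqv φ ψ).fvar) (hφ : x ∈ φ.fvar)
      (hψ : x ∈ ψ.fvar) :
      Ax s (.imp (.all x (.eqv φ ψ) h) (.eqv (.all x φ hφ) (.all x ψ hψ)))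
  | allInst {x : ℕ} {φ : Fm K} (hφ : x ∈ φ.fvar) (ψ : Fm K) :
      Ax s (.imp (.all x φ hφ) (φ.subst₁ x ψ))
  | allImp {x : ℕ} {φ ψ : Fm K} (h : x ∈ (Fm.imp φ ψ).fvar) (hφ : x ∈ φ.fvar)
      (hψ : x ∈ ψ.fvar) :
      Ax s (.imp (.all x (.imp φ ψ) h) (.imp (.all x φ hφ) (.all x ψ hψ)))
  | allImpRight {x : ℕ} {φ ψ : Fm K} (h : x ∈ (Fm.imp φ ψ).fvar) (hφ : x ∉ φ.fvar)
      (hψ : x ∈ ψ.fvar) :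
      Ax s (.imp (.all x (.imp φ ψ) h) (.imp φ (.all x ψ hψ)))
  | barcanConv {x : ℕ} {φ : Fm K} (hφ : x ∈ φ.fvar) (h : x ∈ (Fm.box φ).fvar) :
      Ax s (.imp (.box (.all x φ hφ)) (.all x (.box φ) h))
  | barcan {x : ℕ} {φ : Fm K} (hφ : x ∈ φ.fvar) (h : x ∈ (Fm.box φ).fvar) :
      Ax s (.imp (.all x (.box φ) h) (.box (.all x φ hφ)))
  | four (hs : s = .S4 ∨ s = .S5) (φ : Fm K) : Ax s (.imp (.box φ) (.box (.box φ)))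
  | five (hs : s = .S5) (φ : Fm K) :
      Ax s (.imp (.neg (.box φ)) (.box (.neg (.box φ))))
  | gen {x : ℕ} {φ : Fm K} (hφ : x ∈ φ.fvar) : Ax s φ → Ax s (.all x φ hφ)

/-- `Derives s Φ φ`: there is a derivation of `φ` from `Φ` in the system `s`; the rules are Modus
Ponens and Axiom Necessitation. -/
inductive Derives {K : Type u} (s : Sys) (Φ : Set (Fm K)) : Fm K → Prop
  | hyp {φ : Fm K} : φ ∈ Φ → Derives s Φ φ
  | ax {φ : Fm K} : Ax s φ → Derives s Φ φ
  | an {φ : Fm K} : Ax s φ → Derives s Φ (.box φ)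
  | mp {φ ψ : Fm K} : Derives s Φ φ → Derives s Φ (.imp φ ψ) → Derives s Φ ψ

def Consistent {K : Type u} (s : Sys) (Φ : Set (Fm K)) : Prop := ¬ Derives s Φ Fm.bot

/-- A propositional constant of the language: `⊥`, `⊤` or an element of `K`. -/
def IsConstant {K : Type u} (c : Fm K) : Prop :=
  c = Fm.bot ∨ c = Fm.top ∨ ∃ k : K, c = Fm.const k

/-- A Henkin set is maximally consistent, and derives `∀ x φ` iff it derives `φ[x := c]` for all
constants `c`. -/
structure IsHenkin {K : Type u} (s : Sys) (Φ : Set (Fm K)) : Prop where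
  consistent : Consistent s Φ
  maximal : ∀ Ψ : Set (Fm K), Consistent s Ψ → Φ ⊆ Ψ → Ψ = Φ
  henkin : ∀ (x : ℕ) (φ : Fm K) (hx : x ∈ φ.fvar),
    Derives s Φ (.all x φ hx) ↔ ∀ c : Fm K, IsConstant c → Derives s Φ (φ.subst₁ x c)

/-! ## Boolean prealgebras -/

/-- The equivalence relation `a ≤ b ∧ b ≤ a` of a preorder. -/
def preSetoid {M : Type w} (le : M → M → Prop) (refl : ∀ a, le a a)
    (trans : ∀ a b c, le a b → le b c → le a c) : Setoid M where
  r a b := le a b ∧ le b a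
  iseqv :=
    { refl := fun a => ⟨refl a, refl a⟩
      symm := fun h => ⟨h.2, h.1⟩
      trans := fun h h' => ⟨trans _ _ _ h.1 h'.1, trans _ _ _ h'.2 h.2⟩ }

/-- `le` is a preorder on `M`, the equivalence relation induced by it is a congruence relation, and
the quotient algebra is a Boolean algebra whose lattice order is induced by `le`. -/
structure IsBooleanPrealgebra {M : Type w} (bot top : M) (neg : M → M) (or and imp : M → M → M)
    (le : M → M → Prop) : Prop where
  refl : ∀ a, le a a
  trans : ∀ a b c, le a b → le b c → le a c
  congr_neg : ∀ a a', (le a a' ∧ le a' a) → (le (neg a) (neg a') ∧ le (neg a') (neg a))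
  congr_or : ∀ a a' b b', (le a a' ∧ le a' a) → (le b b' ∧ le b' b) →
    (le (or a b) (or a' b') ∧ le (or a' b') (or a b))
  congr_and : ∀ a a' b b', (le a a' ∧ le a' a) → (le b b' ∧ le b' b) →
    (le (and a b) (and a' b') ∧ le (and a' b') (and a b))
  congr_imp : ∀ a a' b b', (le a a' ∧ le a' a) → (le b b' ∧ le b' b) →
    (le (imp a b) (imp a' b') ∧ le (imp a' b') (imp a b))
  quotient : ∃ (_ : BooleanAlgebra (Quotient (preSetoid le refl trans)))
    (q : M → Quotient (preSetoid le refl trans)), q = Quotient.mk _ ∧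
    (∀ a b, q a ≤ q b ↔ le a b) ∧ q bot = ⊥ ∧ q top = ⊤ ∧ (∀ a, q (neg a) = (q a)ᶜ) ∧
    (∀ a b, q (or a b) = q a ⊔ q b) ∧ (∀ a b, q (and a b) = q a ⊓ q b) ∧
    (∀ a b, q (imp a b) = q a ⇨ q b)

/-- Filters of a Boolean prealgebra with preorder `le`. -/
structure IsPreFilter {M : Type w} (bot : M) (and : M → M → M) (le : M → M → Prop)
    (F : Set M) : Prop where
  nonempty : F.Nonempty
  up : ∀ a b, a ∈ F → le a b → b ∈ F
  and_mem : ∀ a b, a ∈ F → b ∈ F → and a b ∈ F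
  bot_notMem : bot ∉ F

/-! ## Models -/

/-- Propositional domains with universe `M` for the language with constants `{⊥, ⊤} ∪ K`. The
Gamma-function maps `⊥`, `⊤` to `fbot`, `ftop`, and is given by `Gam` on the other constants. -/
structure PropDomain (K : Type u) (M : Type w) where
  TRUE : Set M
  NEC : Set M
  fbot : M
  ftop : M
  fbox : M → M
  fneg : M → M
  fdisj : M → M → M
  fconj : M → M → M
  fimp : M → M → M
  feqv : M → M → M
  fall : (M → M) → M
  Gam : K → M

namespace PropDomain

variable {K : Type u} {M : Type w}

/-- The extension of an assignment `γ` to all expressions. -/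
def evalPre (D : PropDomain K M) : PreFm K → (ℕ → M) → M
  | .var x, γ => γ x
  | .const c, _ => D.Gam c
  | .bot, _ => D.fbot
  | .top, _ => D.ftop
  | .neg φ, γ => D.fneg (evalPre D φ γ)
  | .box φ, γ => D.fbox (evalPre D φ γ)
  | .imp φ ψ, γ => D.fimp (evalPre D φ γ) (evalPre D ψ γ)
  | .or φ ψ, γ => D.fdisj (evalPre D φ γ) (evalPre D ψ γ)
  | .and φ ψ, γ => D.fconj (evalPre D φ γ) (evalPre D ψ γ)
  | .eqv φ ψ, γ => D.feqv (evalPre D φ γ) (evalPre D ψ γ)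
  | .all x φ, γ => D.fall fun m => evalPre D φ (Function.update γ x m)

/-- The denotation `γ(φ)` of the formula `φ` under the assignment `γ`. -/
def eval (D : PropDomain K M) (γ : ℕ → M) (φ : Fm K) : M := D.evalPre φ.1 γ

/-- `t` is `(φ, x, γ)`-definable. -/
def DefinableBy (D : PropDomain K M) (φ : Fm K) (x : ℕ) (γ : ℕ → M) (t : M → M) : Prop :=
  x ∈ φ.fvar ∧ ∀ m, t m = D.eval (Function.update γ x m) φ

/-- `t` is definable. -/
def Definable (D : PropDomain K M) (t : M → M) : Prop :=
  ∃ (φ : Fm K) (x : ℕ) (γ : ℕ → M), D.DefinableBy φ x γ t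

/-- The relation `a ≤ b` iff `f_→(a, b) ∈ NEC`. -/
def le (D : PropDomain K M) (a b : M) : Prop := D.fimp a b ∈ D.NEC

/-- The truth conditions. -/
structure TruthConditions (D : PropDomain K M) : Prop where
  bot : D.fbot ∉ D.TRUE
  top : D.ftop ∈ D.TRUE
  imp : ∀ a b, D.fimp a b ∈ D.TRUE ↔ (a ∉ D.TRUE ∨ b ∈ D.TRUE)
  neg : ∀ a, D.fneg a ∈ D.TRUE ↔ a ∉ D.TRUE
  and : ∀ a b, D.fconj a b ∈ D.TRUE ↔ (a ∈ D.TRUE ∧ b ∈ D.TRUE)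
  or : ∀ a b, D.fdisj a b ∈ D.TRUE ↔ (a ∈ D.TRUE ∨ b ∈ D.TRUE)
  box : ∀ a, D.fbox a ∈ D.TRUE ↔ a ∈ D.NEC
  eqv : ∀ a b, D.feqv a b ∈ D.TRUE ↔ a = b
  all : ∀ t, D.Definable t → (∀ m, t m ∈ D.TRUE) → D.fall t ∈ D.TRUE

/-- The conditions on the preorder that are imposed if `NEC` is non-empty. -/
structure OrderConditions (D : PropDomain K M) : Prop where
  eqv_refl : ∀ a, D.le D.ftop (D.feqv a a)
  eqv_imp : ∀ a b, D.le (D.feqv a b) (D.fimp a b)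
  eqv_subst : ∀ a b t, D.Definable t → D.le (D.feqv a b) (D.feqv (t a) (t b))
  box_le : ∀ a, D.le (D.fbox a) a
  box_imp : ∀ a b, D.le (D.fbox (D.fimp a b)) (D.fimp (D.fbox a) (D.fbox b))
  box_imp_box : ∀ a b,
    D.le (D.fbox (D.fimp a b)) (D.fbox (D.fimp (D.fbox a) (D.fbox b)))
  all_eqv : ∀ (φ ψ : Fm K) (x : ℕ) (γ : ℕ → M) (t₁ t₂ : M → M),
    D.DefinableBy φ x γ t₁ → D.DefinableBy ψ x γ t₂ →
    D.le (D.fall fun a => D.feqv (t₁ a) (t₂ a)) (D.feqv (D.fall t₁) (D.fall t₂))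
  all_le : ∀ t, D.Definable t → ∀ a, D.le (D.fall t) (t a)
  all_imp : ∀ (φ ψ : Fm K) (x : ℕ) (γ : ℕ → M) (t₁ t₂ : M → M),
    D.DefinableBy φ x γ t₁ → D.DefinableBy ψ x γ t₂ →
    D.le (D.fall fun a => D.fimp (t₁ a) (t₂ a)) (D.fimp (D.fall t₁) (D.fall t₂))
  all_imp_right : ∀ (φ ψ : Fm K) (x : ℕ) (γ : ℕ → M) (t' : M → M),
    x ∉ φ.fvar → D.DefinableBy ψ x γ t' →
    D.le (D.fall fun a => D.fimp (D.eval γ φ) (t' a)) (D.fimp (D.eval γ φ) (D.fall t'))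
  box_all : ∀ t, D.Definable t →
    D.le (D.fbox (D.fall t)) (D.fall fun a => D.fbox (t a)) ∧
    D.le (D.fall fun a => D.fbox (t a)) (D.fbox (D.fall t))
  all_nec : ∀ t, D.Definable t → (∀ m, t m ∈ D.NEC) → D.fall t ∈ D.NEC

/-- Models of the S3-system, normal or not. -/
structure IsS3Model (D : PropDomain K M) : Prop where
  prealgebra : D.NEC.Nonempty →
    IsBooleanPrealgebra D.fbot D.ftop D.fneg D.fdisj D.fconj D.fimp D.le
  truth : D.TruthConditions
  nec_subset : D.NEC.Nonempty → D.NEC ⊆ D.TRUE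
  nec_filter : D.NEC.Nonempty → IsPreFilter D.fbot D.fconj D.le D.NEC
  order : D.NEC.Nonempty → D.OrderConditions

/-- Normal models of the S3-system, and the (normal) models of the S4- and S5-systems. -/
def IsNormalModel (D : PropDomain K M) : Sys → Prop
  | .S3 => D.IsS3Model ∧ D.NEC.Nonempty
  | .S4 => (D.IsS3Model ∧ D.NEC.Nonempty) ∧ ∀ a, D.le (D.fbox a) (D.fbox (D.fbox a))
  | .S5 => ((D.IsS3Model ∧ D.NEC.Nonempty) ∧ ∀ a, D.le (D.fbox a) (D.fbox (D.fbox a))) ∧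
      ∀ a, D.le (D.fneg (D.fbox a)) (D.fbox (D.fneg (D.fbox a)))

/-- `(D, γ) ⊨ φ` -/
def Sat (D : PropDomain K M) (γ : ℕ → M) (φ : Fm K) : Prop := D.eval γ φ ∈ D.TRUE

end PropDomain

/-- `φ` is a logical consequence of `Φ` over the class of all normal models of the system `s`. -/
def Consequence {K : Type u} (s : Sys) (Φ : Set (Fm K)) (φ : Fm K) : Prop :=
  ∀ (M : Type (max u v)) (D : PropDomain K M), D.IsNormalModel s →
    ∀ γ : ℕ → M, (∀ ψ ∈ Φ, D.Sat γ ψ) → D.Sat γ φ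

/-- `Φ` is satisfied in some normal model of the system `s` under some assignment. -/
def HasNormalModel {K : Type u} (s : Sys) (Φ : Set (Fm K)) : Prop :=
  ∃ (M : Type (max u v)) (D : PropDomain K M), D.IsNormalModel s ∧
    ∃ γ : ℕ → M, ∀ ψ ∈ Φ, D.Sat γ ψ

end NFL

namespace NFL

/-! ## Simultaneous substitution for variables and constants -/

/-! Soundness shows more than truth: every axiom denotes an element of `NEC` under every assignment
(`eval_mem_nec`). Membership in `NEC` gives truth of the boxed axiom, and uniformity in the
assignment carries the closure of the axioms under generalization. Tautologies are handled in the
Boolean quotient, where the prime ideal theorem reduces their validity to two-valued truth.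

For a Henkin set, the model consists of the formulas modulo provable `≡`, which is a congruence by
the substitution axiom for `≡`. The delicate operation is `fall`, whose argument is a function and
not a formula. A function represented by `χ` in the variable `z` is sent to the class of `∀ z χ`. If
two formulas represent the same function, their instances at all constants are provably identical;
the Henkin property turns this into a universally quantified identity, and the axiom on `∀ x (φ ≡
ψ)` identifies the two quantified formulas (`eqv_all_of_represents`). Evaluation is then
substitution (`eval_mk`), all definable functions are represented, and each condition on models is
an instance of an axiom or of the Henkin property. The Barcan formula is what puts `fall t` into
`NEC` when all values of `t` are there.

A consistent set is made Henkin in a language with new constants. One inductive type supplies a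
witness for every quantified formula over the extended language itself, so no chain of languages is
needed. The axioms `φ[x := c] → ∀ x φ` are consistent with the given set: in a finite collection the
witness of greatest size occurs in no other member, so it can be generalized away (`gen_const`).
After maximalization, the canonical model is restricted to the original language; the model
conditions survive because they concern definable functions only, and the smaller language defines
no new ones. Completeness follows by refuting `¬ φ`.

The syntactic work rests on a simultaneous substitution `gs` for variables and constants. Since
every substitution renames bound variables in a forced way, `gs` composes on the nose and gives
literally equal results on alpha-congruent formulas; `φ.gs ids` is thus a normal form of `φ`, and
identities that would hold only up to alpha become equations between normal forms. -/

/-- The environment `ρ`, with the value at the variable `x` changed to `a`. -/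
def setVar {K : Type u} {A : Type w} (ρ : ℕ ⊕ K → A) (x : ℕ) (a : A) : ℕ ⊕ K → A :=
  Sum.elim (Function.update (fun y => ρ (.inl y)) x a) fun k => ρ (.inr k)

section setVar

variable {K : Type u} {A : Type w} (ρ : ℕ ⊕ K → A) (x : ℕ) (a : A)

@[simp] theorem setVar_same : setVar ρ x a (.inl x) = a := by simp [setVar]

@[simp] theorem setVar_inr (k : K) : setVar ρ x a (.inr k) = ρ (.inr k) := rfl

theorem setVar_of_ne {p : ℕ ⊕ K} (h : p ≠ .inl x) : setVar ρ x a p = ρ p := by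
  rcases p with y | k
  · have : y ≠ x := fun h' => h (by rw [h'])
    simp [setVar, this]
  · rfl

theorem comp_setVar {B : Type v} (f : A → B) :
    (fun p => f (setVar ρ x a p)) = setVar (fun p => f (ρ p)) x (f a) := by
  funext p
  by_cases h : p = .inl x
  · subst h; simp
  · simp [setVar_of_ne _ _ _ h]

end setVar

namespace PreFm

variable {K : Type u} {L : Type v}

open Classical in
/-- The free variables and the constants (other than `⊥`, `⊤`) of an expression. -/
noncomputable def ob : PreFm K → Finset (ℕ ⊕ K)
  | var x => {.inl x}
  | const c => {.inr c}
  | bot => ∅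
  | top => ∅
  | neg φ => ob φ
  | box φ => ob φ
  | imp φ ψ => ob φ ∪ ob ψ
  | or φ ψ => ob φ ∪ ob ψ
  | and φ ψ => ob φ ∪ ob ψ
  | eqv φ ψ => ob φ ∪ ob ψ
  | all x φ => (ob φ).erase (.inl x)

theorem inl_mem_ob {x : ℕ} (φ : PreFm K) : .inl x ∈ φ.ob ↔ x ∈ φ.fvar := by
  induction φ with
  | var y | const c | bot | top => simp [ob, fvar]
  | neg φ ih | box φ ih => simpa [ob, fvar] using ih
  | imp φ ψ ih1 ih2 | or φ ψ ih1 ih2 | and φ ψ ih1 ih2 | eqv φ ψ ih1 ih2 =>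
    simp [ob, fvar, ih1, ih2]
  | all y φ ih => simp [ob, fvar, ih]

theorem mem_ob_all {p : ℕ ⊕ K} {x : ℕ} {φ : PreFm K} :
    p ∈ (all x φ).ob ↔ p ≠ .inl x ∧ p ∈ φ.ob := by simp [ob]

/-- The least variable greater than all free variables of all `ρ p` with `p ∈ S`. -/
def freshFor (ρ : ℕ ⊕ K → PreFm L) (S : Finset (ℕ ⊕ K)) : ℕ :=
  (S.biUnion fun p => fvar (ρ p)).sup fun z => z + 1

theorem freshFor_notMem {ρ : ℕ ⊕ K → PreFm L} {S : Finset (ℕ ⊕ K)} {p : ℕ ⊕ K} (hp : p ∈ S) :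
    freshFor ρ S ∉ fvar (ρ p) := by
  intro h
  have h' : freshFor ρ S ∈ S.biUnion fun p => fvar (ρ p) := Finset.mem_biUnion.2 ⟨p, hp, h⟩
  have := Finset.le_sup (f := fun z : ℕ => z + 1) h'
  exact absurd this (Nat.not_succ_le_self _)

/-- Capture-avoiding simultaneous substitution for variables and constants. -/
noncomputable def gs : PreFm K → (ℕ ⊕ K → PreFm L) → PreFm L
  | var x, ρ => ρ (.inl x)
  | const c, ρ => ρ (.inr c)
  | bot, _ => bot
  | top, _ => top
  | neg φ, ρ => neg (gs φ ρ)
  | box φ, ρ => box (gs φ ρ)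
  | imp φ ψ, ρ => imp (gs φ ρ) (gs ψ ρ)
  | or φ ψ, ρ => or (gs φ ρ) (gs ψ ρ)
  | and φ ψ, ρ => and (gs φ ρ) (gs ψ ρ)
  | eqv φ ψ, ρ => eqv (gs φ ρ) (gs ψ ρ)
  | all x φ, ρ =>
      all (freshFor ρ (all x φ).ob) (gs φ (setVar ρ x (var (freshFor ρ (all x φ).ob))))

theorem freshFor_congr {ρ ρ' : ℕ ⊕ K → PreFm L} {S : Finset (ℕ ⊕ K)} (h : ∀ p ∈ S, ρ p = ρ' p) :
    freshFor ρ S = freshFor ρ' S := by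
  unfold freshFor
  congr 1
  exact Finset.biUnion_congr rfl fun p hp => by rw [h p hp]

theorem gs_congr (φ : PreFm K) : ∀ {ρ ρ' : ℕ ⊕ K → PreFm L}, (∀ p ∈ φ.ob, ρ p = ρ' p) →
    gs φ ρ = gs φ ρ' := by
  induction φ with
  | var x | const c => intro ρ ρ' h; exact h _ (by simp [ob])
  | bot | top => intros; rfl
  | neg φ ih | box φ ih => intro ρ ρ' h; simp only [gs]; rw [ih h]
  | imp φ ψ ih1 ih2 | or φ ψ ih1 ih2 | and φ ψ ih1 ih2 | eqv φ ψ ih1 ih2 =>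
    intro ρ ρ' h
    simp only [gs]
    rw [ih1 fun p hp => h p (by simp [ob, hp]), ih2 fun p hp => h p (by simp [ob, hp])]
  | all x φ ih =>
    intro ρ ρ' h
    simp only [gs]
    rw [freshFor_congr h]
    congr 1
    apply ih
    intro p hp
    by_cases hx : p = .inl x
    · subst hx; simp
    · rw [setVar_of_ne _ _ _ hx, setVar_of_ne _ _ _ hx]
      exact h p (mem_ob_all.2 ⟨hx, hp⟩)

theorem mem_ob_gs (φ : PreFm K) : ∀ (ρ : ℕ ⊕ K → PreFm L) {o : ℕ ⊕ L},
    o ∈ (gs φ ρ).ob ↔ ∃ p ∈ φ.ob, o ∈ (ρ p).ob := by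
  induction φ with
  | var x | const c | bot | top => intro ρ o; simp [gs, ob]
  | neg φ ih | box φ ih => intro ρ o; exact ih ρ
  | imp φ ψ ih1 ih2 | or φ ψ ih1 ih2 | and φ ψ ih1 ih2 | eqv φ ψ ih1 ih2 =>
    intro ρ o
    simp only [gs, ob, Finset.mem_union, ih1, ih2]
    constructor
    · rintro (⟨p, hp, h⟩ | ⟨p, hp, h⟩)
      · exact ⟨p, .inl hp, h⟩
      · exact ⟨p, .inr hp, h⟩
    · rintro ⟨p, hp | hp, h⟩
      · exact .inl ⟨p, hp, h⟩
      · exact .inr ⟨p, hp, h⟩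
  | all x φ ih =>
    intro ρ o
    simp only [gs]
    rw [mem_ob_all, ih]
    constructor
    · rintro ⟨ho, p, hp, h⟩
      by_cases hx : p = .inl x
      · subst hx
        rw [setVar_same] at h
        exact absurd (by simpa [ob] using h) ho
      · rw [setVar_of_ne _ _ _ hx] at h
        exact ⟨p, mem_ob_all.2 ⟨hx, hp⟩, h⟩
    · rintro ⟨p, hp, h⟩
      have hp' := mem_ob_all.1 hp
      refine ⟨?_, p, hp'.2, by rwa [setVar_of_ne _ _ _ hp'.1]⟩
      rintro rfl
      exact freshFor_notMem hp ((inl_mem_ob _).1 h)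

theorem mem_fvar_gs (φ : PreFm K) (ρ : ℕ ⊕ K → PreFm L) {z : ℕ} :
    z ∈ (gs φ ρ).fvar ↔ ∃ p ∈ φ.ob, z ∈ (ρ p).fvar := by
  simp only [← inl_mem_ob, mem_ob_gs]

/-- The forced variable depends only on the free variables of the result, and these are the same for
two successive substitutions and for their composite. -/
theorem freshFor_gs {J : Type w} (φ : PreFm K) (ρ : ℕ ⊕ K → PreFm L) (ρ' : ℕ ⊕ L → PreFm J) :
    freshFor ρ' (gs φ ρ).ob = freshFor (fun p => gs (ρ p) ρ') φ.ob := by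
  unfold freshFor
  congr 1
  ext z
  simp only [Finset.mem_biUnion, mem_ob_gs, mem_fvar_gs]
  constructor
  · rintro ⟨o, ⟨p, hp, ho⟩, hz⟩
    exact ⟨p, hp, o, ho, hz⟩
  · rintro ⟨p, hp, o, ho, hz⟩
    exact ⟨o, ⟨p, hp, ho⟩, hz⟩

/-- Equality holds on the nose, not merely up to alpha: by `freshFor_gs` both sides choose the same
bound variable, and the intermediate bound variable is fresh for the formulas substituted next to
it. -/
theorem gs_gs {J : Type w} (φ : PreFm K) : ∀ (ρ : ℕ ⊕ K → PreFm L) (ρ' : ℕ ⊕ L → PreFm J),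
    gs (gs φ ρ) ρ' = gs φ fun p => gs (ρ p) ρ' := by
  induction φ with
  | var x | const c | bot | top => intros; rfl
  | neg φ ih | box φ ih => intro ρ ρ'; simp only [gs]; rw [ih]
  | imp φ ψ ih1 ih2 | or φ ψ ih1 ih2 | and φ ψ ih1 ih2 | eqv φ ψ ih1 ih2 =>
    intro ρ ρ'; simp only [gs]; rw [ih1, ih2]
  | all x φ ih =>
    intro ρ ρ'
    have h := freshFor_gs (all x φ) ρ ρ'
    simp only [gs] at h ⊢
    rw [h, ih]
    congr 1
    apply gs_congr
    intro p hp
    by_cases hx : p = .inl x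
    · subst hx; simp [gs]
    · rw [setVar_of_ne _ _ _ hx, setVar_of_ne _ _ _ hx]
      -- The second substitution differs from `ρ'` only at the intermediate bound variable, which
      -- does not occur in `ρ p`.
      apply gs_congr
      intro o ho
      apply setVar_of_ne
      rintro rfl
      exact freshFor_notMem (mem_ob_all.2 ⟨hx, hp⟩) ((inl_mem_ob _).1 ho)

theorem freshFor_elim (σ : ℕ → PreFm K) (χ : PreFm K) :
    freshFor (Sum.elim σ const) χ.ob = forced σ χ := by
  unfold freshFor forced
  congr 1
  ext z
  simp only [Finset.mem_biUnion, ← inl_mem_ob]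
  constructor
  · rintro ⟨p | k, hp, hz⟩
    · exact ⟨p, hp, hz⟩
    · simp [ob] at hz
  · rintro ⟨p, hp, hz⟩
    exact ⟨.inl p, hp, hz⟩

/-- Constants contribute no free variables, so the two forced variables agree. This transfers the
calculus of `gs` to the substitution used in the axioms. -/
theorem subst_eq_gs (φ : PreFm K) : ∀ σ : ℕ → PreFm K, subst φ σ = gs φ (Sum.elim σ const) := by
  induction φ with
  | var x | const c | bot | top => intros; rfl
  | neg φ ih | box φ ih => intro σ; simp only [gs, subst]; rw [ih]
  | imp φ ψ ih1 ih2 | or φ ψ ih1 ih2 | and φ ψ ih1 ih2 | eqv φ ψ ih1 ih2 =>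
    intro σ; simp only [gs, subst]; rw [ih1, ih2]
  | all x φ ih =>
    intro σ
    simp only [gs, subst]
    rw [freshFor_elim, ih]
    rfl

theorem WF.gs {φ : PreFm K} : φ.WF → ∀ {ρ : ℕ ⊕ K → PreFm L}, (∀ p, (ρ p).WF) →
    (φ.gs ρ).WF := by
  induction φ with
  | var x | const c => intro _ ρ hρ; exact hρ _
  | bot | top => intros; trivial
  | neg φ ih | box φ ih => intro h ρ hρ; exact ih h hρ
  | imp φ ψ ih1 ih2 | or φ ψ ih1 ih2 | and φ ψ ih1 ih2 | eqv φ ψ ih1 ih2 =>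
    intro h ρ hρ; exact ⟨ih1 h.1 hρ, ih2 h.2 hρ⟩
  | all x φ ih =>
    intro h ρ hρ
    refine ⟨(mem_fvar_gs _ _).2 ⟨.inl x, (inl_mem_ob _).2 h.1, ?_⟩, ih h.2 ?_⟩
    · simp [fvar]
    · intro p
      by_cases hx : p = .inl x
      · subst hx; simp [WF]
      · rw [setVar_of_ne _ _ _ hx]; exact hρ p

end PreFm

namespace Fm

variable {K : Type u} {L : Type v}

theorem induct {P : Fm K → Prop} (hvar : ∀ x, P (var x)) (hconst : ∀ c, P (const c))
    (hbot : P bot) (htop : P top) (hneg : ∀ φ, P φ → P (neg φ)) (hbox : ∀ φ, P φ → P (box φ))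
    (himp : ∀ φ ψ, P φ → P ψ → P (imp φ ψ)) (hor : ∀ φ ψ, P φ → P ψ → P (or φ ψ))
    (hand : ∀ φ ψ, P φ → P ψ → P (and φ ψ)) (heqv : ∀ φ ψ, P φ → P ψ → P (eqv φ ψ))
    (hall : ∀ x φ hx, P φ → P (all x φ hx)) (φ : Fm K) : P φ := by
  obtain ⟨φ, h⟩ := φ
  induction φ with
  | var x => exact hvar x
  | const c => exact hconst c
  | bot => exact hbot
  | top => exact htop
  | neg φ ih => exact hneg ⟨φ, h⟩ (ih h)
  | box φ ih => exact hbox ⟨φ, h⟩ (ih h)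
  | imp φ ψ ih1 ih2 => exact himp ⟨φ, h.1⟩ ⟨ψ, h.2⟩ (ih1 h.1) (ih2 h.2)
  | or φ ψ ih1 ih2 => exact hor ⟨φ, h.1⟩ ⟨ψ, h.2⟩ (ih1 h.1) (ih2 h.2)
  | and φ ψ ih1 ih2 => exact hand ⟨φ, h.1⟩ ⟨ψ, h.2⟩ (ih1 h.1) (ih2 h.2)
  | eqv φ ψ ih1 ih2 => exact heqv ⟨φ, h.1⟩ ⟨ψ, h.2⟩ (ih1 h.1) (ih2 h.2)
  | all x φ ih => exact hall x ⟨φ, h.2⟩ h.1 (ih h.2)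

/-- The free variables and the constants (other than `⊥`, `⊤`) of a formula. -/
noncomputable def ob (φ : Fm K) : Finset (ℕ ⊕ K) := φ.1.ob

theorem inl_mem_ob {x : ℕ} (φ : Fm K) : .inl x ∈ φ.ob ↔ x ∈ φ.fvar := PreFm.inl_mem_ob φ.1

theorem mem_ob_all {p : ℕ ⊕ K} {x : ℕ} {φ : Fm K} {hx : x ∈ φ.fvar} :
    p ∈ (all x φ hx).ob ↔ p ≠ .inl x ∧ p ∈ φ.ob := PreFm.mem_ob_all

/-- The least variable greater than all free variables of all `ρ p` with `p ∈ S`. -/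
def freshFor (ρ : ℕ ⊕ K → Fm L) (S : Finset (ℕ ⊕ K)) : ℕ :=
  PreFm.freshFor (fun p => (ρ p).1) S

theorem freshFor_notMem {ρ : ℕ ⊕ K → Fm L} {S : Finset (ℕ ⊕ K)} {p : ℕ ⊕ K} (hp : p ∈ S) :
    freshFor ρ S ∉ (ρ p).fvar := PreFm.freshFor_notMem (ρ := fun p => (ρ p).1) hp

/-- Capture-avoiding simultaneous substitution for variables and constants. -/
noncomputable def gs (φ : Fm K) (ρ : ℕ ⊕ K → Fm L) : Fm L :=
  ⟨φ.1.gs fun p => (ρ p).1, φ.2.gs fun p => (ρ p).2⟩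

/-- The identical substitution. -/
def ids : ℕ ⊕ K → Fm K := Sum.elim var const

theorem gs_congr {φ : Fm K} {ρ ρ' : ℕ ⊕ K → Fm L} (h : ∀ p ∈ φ.ob, ρ p = ρ' p) :
    φ.gs ρ = φ.gs ρ' :=
  Subtype.ext (PreFm.gs_congr φ.1 fun p hp => congrArg Subtype.val (h p hp))

theorem mem_ob_gs {φ : Fm K} {ρ : ℕ ⊕ K → Fm L} {o : ℕ ⊕ L} :
    o ∈ (φ.gs ρ).ob ↔ ∃ p ∈ φ.ob, o ∈ (ρ p).ob := PreFm.mem_ob_gs φ.1 _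

theorem mem_fvar_gs {φ : Fm K} {ρ : ℕ ⊕ K → Fm L} {z : ℕ} :
    z ∈ (φ.gs ρ).fvar ↔ ∃ p ∈ φ.ob, z ∈ (ρ p).fvar := PreFm.mem_fvar_gs φ.1 _

theorem gs_gs {J : Type w} (φ : Fm K) (ρ : ℕ ⊕ K → Fm L) (ρ' : ℕ ⊕ L → Fm J) :
    (φ.gs ρ).gs ρ' = φ.gs fun p => (ρ p).gs ρ' :=
  Subtype.ext (PreFm.gs_gs φ.1 _ _)

theorem mem_fvar_var {x z : ℕ} : z ∈ (var x : Fm K).fvar ↔ z = x := by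
  simp [var, fvar, PreFm.fvar]

theorem mem_fvar_gs_setVar {φ : Fm K} {x : ℕ} (hx : x ∈ φ.fvar) (ρ : ℕ ⊕ K → Fm L) (z : ℕ) :
    z ∈ (φ.gs (setVar ρ x (var z))).fvar :=
  mem_fvar_gs.2 ⟨.inl x, (inl_mem_ob φ).2 hx, by rw [setVar_same]; exact mem_fvar_var.2 rfl⟩

theorem gs_all {φ : Fm K} {x : ℕ} (hx : x ∈ φ.fvar) (ρ : ℕ ⊕ K → Fm L) :
    (all x φ hx).gs ρ = all (freshFor ρ (all x φ hx).ob)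
      (φ.gs (setVar ρ x (var (freshFor ρ (all x φ hx).ob)))) (mem_fvar_gs_setVar hx _ _) := by
  apply Subtype.ext
  have h := comp_setVar ρ x (var (freshFor ρ (all x φ hx).ob)) fun χ : Fm L => χ.1
  exact congrArg (fun τ => PreFm.all (freshFor ρ (all x φ hx).ob) (φ.1.gs τ)) h.symm

theorem all_congr {x y : ℕ} {φ ψ : Fm K} (hxy : x = y) (h : φ = ψ) (hx : x ∈ φ.fvar) :
    all x φ hx = all y ψ (hxy ▸ h ▸ hx) := by
  subst hxy; subst h; rfl

theorem subst₁_eq_gs (φ : Fm K) (x : ℕ) (ψ : Fm K) : φ.subst₁ x ψ = φ.gs (setVar ids x ψ) := by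
  apply Subtype.ext
  show φ.1.subst _ = φ.1.gs _
  rw [PreFm.subst_eq_gs]
  congr 1
  funext p
  rcases p with p | k <;> rfl

@[simp] theorem gs_var (x : ℕ) (ρ : ℕ ⊕ K → Fm L) : (var x).gs ρ = ρ (.inl x) := rfl

@[simp] theorem gs_const (c : K) (ρ : ℕ ⊕ K → Fm L) : (const c).gs ρ = ρ (.inr c) := rfl

theorem mem_ob_ids {p o : ℕ ⊕ K} : o ∈ (ids p).ob ↔ o = p := by
  rcases p with p | k <;> simp [ids, var, const, ob, PreFm.ob]

@[simp] theorem ids_gs (p : ℕ ⊕ K) (ρ : ℕ ⊕ K → Fm L) : (ids p).gs ρ = ρ p := by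
  rcases p with p | k <;> rfl

/-- Substituting into a formula, after a substitution that sends `x` to the fresh variable `z`. -/
theorem gs_setVar_subst₁ {φ : Fm K} {x z : ℕ} {ρ : ℕ ⊕ K → Fm L}
    (hz : ∀ p ∈ φ.ob, p ≠ .inl x → z ∉ (ρ p).fvar) (ψ : Fm L) :
    (φ.gs (setVar ρ x (var z))).subst₁ z ψ = φ.gs (setVar (fun p => (ρ p).gs ids) x ψ) := by
  rw [subst₁_eq_gs, gs_gs]
  apply gs_congr
  intro p hp
  by_cases hx : p = .inl x
  · subst hx; simp
  · rw [setVar_of_ne _ _ _ hx, setVar_of_ne _ _ _ hx]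
    apply gs_congr
    intro o ho
    apply setVar_of_ne
    rintro rfl
    exact hz p hp hx ((inl_mem_ob _).1 ho)

theorem subst₁_gs (φ : Fm K) (x : ℕ) (ψ : Fm K) (ρ : ℕ ⊕ K → Fm L) :
    (φ.subst₁ x ψ).gs ρ = φ.gs (setVar ρ x (ψ.gs ρ)) := by
  rw [subst₁_eq_gs, gs_gs]
  apply gs_congr
  intro p _
  by_cases hx : p = .inl x
  · subst hx; simp
  · rw [setVar_of_ne _ _ _ hx, setVar_of_ne _ _ _ hx, ids_gs]

theorem mem_ob_subst₁_var {φ : Fm K} {x y : ℕ} {hx : x ∈ φ.fvar}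
    (hy : y ∉ (all x φ hx).fvar) (hy' : y ∈ (φ.subst₁ x (var y)).fvar) :
    (all y (φ.subst₁ x (var y)) hy').ob = (all x φ hx).ob := by
  ext o
  rw [mem_ob_all, mem_ob_all, subst₁_eq_gs, mem_ob_gs]
  constructor
  · rintro ⟨ho, p, hp, h⟩
    by_cases hpx : p = .inl x
    · subst hpx
      rw [setVar_same] at h
      exact absurd (mem_ob_ids (p := .inl y).1 h) ho
    · rw [setVar_of_ne _ _ _ hpx] at h
      obtain rfl := mem_ob_ids.1 h
      exact ⟨hpx, hp⟩
  · rintro ⟨hox, ho⟩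
    refine ⟨?_, o, ho, by rw [setVar_of_ne _ _ _ hox]; exact mem_ob_ids.2 rfl⟩
    rintro rfl
    exact hy ((inl_mem_ob _).1 (mem_ob_all.2 ⟨hox, ho⟩))

/-! ### Alpha-congruence and normal forms -/

namespace Alpha

theorem ob_eq {φ ψ : Fm K} (h : Alpha φ ψ) : φ.ob = ψ.ob := by
  induction h with
  | rename hx hy hy' => exact (mem_ob_subst₁_var hy hy').symm
  | refl φ => rfl
  | symm _ ih => exact ih.symm
  | trans _ _ ih1 ih2 => exact ih1.trans ih2
  | neg _ ih => exact ih
  | box _ ih => exact ih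
  | imp _ _ ih1 ih2 | or _ _ ih1 ih2 | and _ _ ih1 ih2 | eqv _ _ ih1 ih2 =>
    ext o
    simp only [ob] at ih1 ih2
    simp [ob, Fm.imp, Fm.or, Fm.and, Fm.eqv, PreFm.ob, ih1, ih2]
  | all hx hx' _ ih =>
    ext o
    rw [mem_ob_all, mem_ob_all, ih]

theorem mem_fvar {φ ψ : Fm K} (h : Alpha φ ψ) {x : ℕ} (hx : x ∈ φ.fvar) : x ∈ ψ.fvar := by
  rwa [← inl_mem_ob, ← h.ob_eq, inl_mem_ob]

/-- The bound names of the argument are discarded and the new ones are determined by `ρ` and the set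
`ob`, which is an alpha-invariant. -/
theorem gs_eq {φ ψ : Fm K} (h : Alpha φ ψ) : ∀ ρ : ℕ ⊕ K → Fm L, φ.gs ρ = ψ.gs ρ := by
  induction h with
  | @rename x y φ hx hy hy' =>
    intro ρ
    rw [gs_all, gs_all]
    apply all_congr
    · rw [mem_ob_subst₁_var hy hy']
    · rw [mem_ob_subst₁_var hy hy', subst₁_gs, gs_var, setVar_same]
      apply gs_congr
      intro p hp
      by_cases hpx : p = .inl x
      · subst hpx; simp
      · rw [setVar_of_ne _ _ _ hpx, setVar_of_ne _ _ _ hpx, setVar_of_ne]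
        rintro rfl
        exact hy ((inl_mem_ob _).1 (mem_ob_all.2 ⟨hpx, hp⟩))
  | refl φ => intro ρ; rfl
  | symm _ ih => intro ρ; exact (ih ρ).symm
  | trans _ _ ih1 ih2 => intro ρ; exact (ih1 ρ).trans (ih2 ρ)
  | neg _ ih => intro ρ; exact congrArg Fm.neg (ih ρ)
  | box _ ih => intro ρ; exact congrArg Fm.box (ih ρ)
  | imp _ _ ih1 ih2 => intro ρ; exact congrArg₂ Fm.imp (ih1 ρ) (ih2 ρ)
  | or _ _ ih1 ih2 => intro ρ; exact congrArg₂ Fm.or (ih1 ρ) (ih2 ρ)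
  | and _ _ ih1 ih2 => intro ρ; exact congrArg₂ Fm.and (ih1 ρ) (ih2 ρ)
  | eqv _ _ ih1 ih2 => intro ρ; exact congrArg₂ Fm.eqv (ih1 ρ) (ih2 ρ)
  | @all x φ φ' hx hx' h ih =>
    intro ρ
    have hob : (Fm.all x φ hx).ob = (Fm.all x φ' hx').ob := (Alpha.all hx hx' h).ob_eq
    rw [gs_all, gs_all]
    apply all_congr
    · rw [hob]
    · rw [ih, hob]

/-- Together with `gs_eq` this makes `φ.gs ids` a canonical representative of the alpha-class of
`φ`. The quantifier case is a single `rename`, since the forced variable exceeds all free variables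
of `∀ x φ`. -/
theorem gs_ids (φ : Fm K) : Alpha φ (φ.gs ids) := by
  induction φ using Fm.induct with
  | hvar x => exact .refl _
  | hconst c => exact .refl _
  | hbot => exact .refl _
  | htop => exact .refl _
  | hneg φ ih => exact .neg ih
  | hbox φ ih => exact .box ih
  | himp φ ψ ih1 ih2 => exact .imp ih1 ih2
  | hor φ ψ ih1 ih2 => exact .or ih1 ih2
  | hand φ ψ ih1 ih2 => exact .and ih1 ih2
  | heqv φ ψ ih1 ih2 => exact .eqv ih1 ih2
  | hall x φ hx _ =>
    have hfresh : freshFor ids (Fm.all x φ hx).ob ∉ (Fm.all x φ hx).fvar := by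
      intro h
      exact freshFor_notMem (ρ := ids) ((inl_mem_ob _).2 h) (mem_fvar_var.2 rfl)
    have hmem := mem_fvar_gs_setVar hx ids (freshFor ids (Fm.all x φ hx).ob)
    have := Alpha.rename hx hfresh (by rwa [subst₁_eq_gs])
    rw [gs_all]
    convert this using 2
    rw [subst₁_eq_gs]

/-- The bound variable introduced by a substitution can be replaced by any fresh variable. -/
theorem gs_all {φ : Fm K} {x z : ℕ} (hx : x ∈ φ.fvar) {ρ : ℕ ⊕ K → Fm L}
    (hρ : ∀ p, (ρ p).gs ids = ρ p) (hz : ∀ p ∈ φ.ob, p ≠ .inl x → z ∉ (ρ p).fvar) :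
    Alpha ((Fm.all x φ hx).gs ρ)
      (Fm.all z (φ.gs (setVar ρ x (var z))) (mem_fvar_gs_setVar hx _ _)) := by
  have hz' : z ∉ ((Fm.all x φ hx).gs ρ).fvar := by
    rw [mem_fvar_gs]
    rintro ⟨p, hp, h⟩
    exact hz p (mem_ob_all.1 hp).2 (mem_ob_all.1 hp).1 h
  have key : (φ.gs (setVar ρ x (var (freshFor ρ (Fm.all x φ hx).ob)))).subst₁
      (freshFor ρ (Fm.all x φ hx).ob) (var z) = φ.gs (setVar ρ x (var z)) := by
    rw [gs_setVar_subst₁]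
    · simp only [hρ]
    · intro p hp hpx
      exact freshFor_notMem (mem_ob_all.2 ⟨hpx, hp⟩)
  rw [Fm.gs_all] at hz' ⊢
  have := Alpha.rename _ hz' (by rw [key]; exact mem_fvar_gs_setVar hx _ _)
  convert this using 2
  rw [key]

end Alpha

end Fm

end NFL

namespace NFL

/-! ## Derivations -/

namespace Fm

variable {K : Type u} {L : Type v}

theorem mem_fvar_imp {φ ψ : Fm K} {x : ℕ} : x ∈ (imp φ ψ).fvar ↔ x ∈ φ.fvar ∨ x ∈ ψ.fvar :=
  Finset.mem_union

theorem mem_fvar_eqv {φ ψ : Fm K} {x : ℕ} : x ∈ (eqv φ ψ).fvar ↔ x ∈ φ.fvar ∨ x ∈ ψ.fvar :=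
  Finset.mem_union

theorem mem_fvar_all {φ : Fm K} {x y : ℕ} {hx : x ∈ φ.fvar} :
    y ∈ (all x φ hx).fvar ↔ y ≠ x ∧ y ∈ φ.fvar := Finset.mem_erase

theorem mem_ob_imp {φ ψ : Fm K} {p : ℕ ⊕ K} : p ∈ (imp φ ψ).ob ↔ p ∈ φ.ob ∨ p ∈ ψ.ob := by
  simp [ob, imp, PreFm.ob]

theorem mem_ob_eqv {φ ψ : Fm K} {p : ℕ ⊕ K} : p ∈ (eqv φ ψ).ob ↔ p ∈ φ.ob ∨ p ∈ ψ.ob := by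
  simp [ob, eqv, PreFm.ob]

theorem gs_box (φ : Fm K) (ρ : ℕ ⊕ K → Fm L) : (box φ).gs ρ = box (φ.gs ρ) := rfl

theorem gs_imp (φ ψ : Fm K) (ρ : ℕ ⊕ K → Fm L) : (imp φ ψ).gs ρ = imp (φ.gs ρ) (ψ.gs ρ) := rfl

theorem gs_eqv (φ ψ : Fm K) (ρ : ℕ ⊕ K → Fm L) : (eqv φ ψ).gs ρ = eqv (φ.gs ρ) (ψ.gs ρ) := rfl

theorem gs_ids_of_normal_setVar {ρ : ℕ ⊕ K → Fm L} (hρ : ∀ p, (ρ p).gs ids = ρ p) {x : ℕ}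
    {χ : Fm L} (hχ : χ.gs ids = χ) (p : ℕ ⊕ K) : (setVar ρ x χ p).gs ids = setVar ρ x χ p := by
  by_cases h : p = .inl x
  · subst h; simpa using hχ
  · rw [setVar_of_ne _ _ _ h, hρ]

/-- The sequence `φ, ψ, χ, χ, …`. -/
def seq (φ ψ χ : Fm K) : ℕ → Fm K
  | 0 => φ
  | 1 => ψ
  | _ => χ

end Fm

theorem PropFm.inst_gs {K : Type u} {L : Type v} (σ : ℕ → Fm K) (ρ : ℕ ⊕ K → Fm L) (p : PropFm) :
    (p.inst σ).gs ρ = p.inst fun x => (σ x).gs ρ := by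
  induction p with
  | var x | bot | top => rfl
  | neg p ih => exact congrArg Fm.neg ih
  | imp p q ih1 ih2 => exact congrArg₂ Fm.imp ih1 ih2
  | or p q ih1 ih2 => exact congrArg₂ Fm.or ih1 ih2
  | and p q ih1 ih2 => exact congrArg₂ Fm.and ih1 ih2

section Ax

variable {K : Type u} {L : Type v} {s : Sys}

open Fm (freshFor)

/-- Up to alpha is the best possible: the quantifiers of one axiom may be renamed to different
variables by the substitution, whereas the axiom schemes require a common one. The values of `ρ` are
assumed to be in normal form so that a further substitution for the fresh variable leaves them
untouched. -/
theorem Ax.exists_alpha_gs {φ : Fm K} (h : Ax s φ) : ∀ {ρ : ℕ ⊕ K → Fm L},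
    (∀ p, (ρ p).gs Fm.ids = ρ p) → ∃ ψ, Ax s ψ ∧ Fm.Alpha (φ.gs ρ) ψ := by
  induction h with
  | taut h σ => intro ρ _; exact ⟨_, .taut h _, by rw [PropFm.inst_gs]; exact .refl _⟩
  | T φ => intro ρ _; exact ⟨_, .T (φ.gs ρ), .refl _⟩
  | distr φ ψ => intro ρ _; exact ⟨_, .distr (φ.gs ρ) (ψ.gs ρ), .refl _⟩
  | distrBox φ ψ => intro ρ _; exact ⟨_, .distrBox (φ.gs ρ) (ψ.gs ρ), .refl _⟩
  | @alpha φ ψ h =>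
    intro ρ _
    refine ⟨_, .alpha (.refl (φ.gs ρ)), ?_⟩
    show Fm.Alpha (Fm.eqv (φ.gs ρ) (ψ.gs ρ)) _
    rw [h.gs_eq ρ]
    exact .refl _
  | eqvImp φ ψ => intro ρ _; exact ⟨_, .eqvImp (φ.gs ρ) (ψ.gs ρ), .refl _⟩
  | @eqvSubst x φ hx ψ ψ' =>
    intro ρ hρ
    refine ⟨_, .eqvSubst (Fm.mem_fvar_gs_setVar hx ρ (freshFor ρ (Fm.all x φ hx).ob))
      (ψ.gs ρ) (ψ'.gs ρ), ?_⟩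
    have hz : ∀ p ∈ φ.ob, p ≠ .inl x → freshFor ρ (Fm.all x φ hx).ob ∉ (ρ p).fvar :=
      fun p hp hpx => Fm.freshFor_notMem (Fm.mem_ob_all.2 ⟨hpx, hp⟩)
    rw [Fm.gs_setVar_subst₁ hz, Fm.gs_setVar_subst₁ hz]
    simp only [hρ]
    rw [← Fm.subst₁_gs, ← Fm.subst₁_gs]
    exact .refl _
  | @allEqv x φ ψ h hφ hψ =>
    intro ρ hρ
    have hz : ∀ p ∈ (Fm.eqv φ ψ).ob, p ≠ .inl x →
        freshFor ρ (Fm.all x (Fm.eqv φ ψ) h).ob ∉ (ρ p).fvar :=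
      fun p hp hpx => Fm.freshFor_notMem (Fm.mem_ob_all.2 ⟨hpx, hp⟩)
    have h1 := Fm.Alpha.gs_all h hρ hz
    have h2 := Fm.Alpha.gs_all hφ hρ fun p hp => hz p (Fm.mem_ob_eqv.2 (.inl hp))
    have h3 := Fm.Alpha.gs_all hψ hρ fun p hp => hz p (Fm.mem_ob_eqv.2 (.inr hp))
    rw [Fm.gs_imp, Fm.gs_eqv]
    exact ⟨_, .allEqv _ _ _, .imp h1 (.eqv h2 h3)⟩
  | @allInst x φ hφ ψ =>
    intro ρ hρ
    have hz : ∀ p ∈ φ.ob, p ≠ .inl x → freshFor ρ (Fm.all x φ hφ).ob ∉ (ρ p).fvar :=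
      fun p hp hpx => Fm.freshFor_notMem (Fm.mem_ob_all.2 ⟨hpx, hp⟩)
    refine ⟨_, .allInst (Fm.mem_fvar_gs_setVar hφ ρ (freshFor ρ (Fm.all x φ hφ).ob)) (ψ.gs ρ), ?_⟩
    rw [Fm.gs_imp, Fm.gs_setVar_subst₁ hz]
    simp only [hρ]
    rw [← Fm.subst₁_gs]
    exact .imp (.gs_all hφ hρ hz) (.refl _)
  | @allImp x φ ψ h hφ hψ =>
    intro ρ hρ
    have hz : ∀ p ∈ (Fm.imp φ ψ).ob, p ≠ .inl x →
        freshFor ρ (Fm.all x (Fm.imp φ ψ) h).ob ∉ (ρ p).fvar :=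
      fun p hp hpx => Fm.freshFor_notMem (Fm.mem_ob_all.2 ⟨hpx, hp⟩)
    have h1 := Fm.Alpha.gs_all h hρ hz
    have h2 := Fm.Alpha.gs_all hφ hρ fun p hp => hz p (Fm.mem_ob_imp.2 (.inl hp))
    have h3 := Fm.Alpha.gs_all hψ hρ fun p hp => hz p (Fm.mem_ob_imp.2 (.inr hp))
    rw [Fm.gs_imp, Fm.gs_imp]
    exact ⟨_, .allImp _ _ _, .imp h1 (.imp h2 h3)⟩
  | @allImpRight x φ ψ h hφ hψ =>
    intro ρ hρ
    have hz : ∀ p ∈ (Fm.imp φ ψ).ob, p ≠ .inl x →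
        freshFor ρ (Fm.all x (Fm.imp φ ψ) h).ob ∉ (ρ p).fvar :=
      fun p hp hpx => Fm.freshFor_notMem (Fm.mem_ob_all.2 ⟨hpx, hp⟩)
    have hne : ∀ p ∈ φ.ob, p ≠ .inl x := by
      rintro p hp rfl
      exact hφ ((Fm.inl_mem_ob _).1 hp)
    have hφ' : φ.gs (setVar ρ x (Fm.var (freshFor ρ (Fm.all x (Fm.imp φ ψ) h).ob))) = φ.gs ρ :=
      Fm.gs_congr fun p hp => setVar_of_ne _ _ _ (hne p hp)
    have hmem : freshFor ρ (Fm.all x (Fm.imp φ ψ) h).ob ∉ (φ.gs ρ).fvar := by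
      rw [Fm.mem_fvar_gs]
      rintro ⟨p, hp, hmem⟩
      exact hz p (Fm.mem_ob_imp.2 (.inl hp)) (hne p hp) hmem
    have h1 := Fm.Alpha.gs_all h hρ hz
    have h3 := Fm.Alpha.gs_all hψ hρ fun p hp => hz p (Fm.mem_ob_imp.2 (.inr hp))
    simp only [Fm.gs_imp, hφ'] at h1 ⊢
    exact ⟨_, .allImpRight _ hmem _, .imp h1 (.imp (.refl _) h3)⟩
  | @barcanConv x φ hφ h =>
    intro ρ hρ
    have hz : ∀ p ∈ φ.ob, p ≠ .inl x → freshFor ρ (Fm.all x φ hφ).ob ∉ (ρ p).fvar :=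
      fun p hp hpx => Fm.freshFor_notMem (Fm.mem_ob_all.2 ⟨hpx, hp⟩)
    have h1 := Fm.Alpha.gs_all hφ hρ hz
    have h2 := Fm.Alpha.gs_all h hρ hz
    rw [Fm.gs_imp, Fm.gs_box]
    exact ⟨_, .barcanConv _ _, .imp h1.box h2⟩
  | @barcan x φ hφ h =>
    intro ρ hρ
    have hz : ∀ p ∈ φ.ob, p ≠ .inl x → freshFor ρ (Fm.all x φ hφ).ob ∉ (ρ p).fvar :=
      fun p hp hpx => Fm.freshFor_notMem (Fm.mem_ob_all.2 ⟨hpx, hp⟩)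
    have h1 := Fm.Alpha.gs_all hφ hρ hz
    have h2 := Fm.Alpha.gs_all h hρ hz
    rw [Fm.gs_imp, Fm.gs_box]
    exact ⟨_, .barcan _ _, .imp h2 h1.box⟩
  | four hs φ => intro ρ _; exact ⟨_, .four hs (φ.gs ρ), .refl _⟩
  | five hs φ => intro ρ _; exact ⟨_, .five hs (φ.gs ρ), .refl _⟩
  | @gen x φ hφ _ ih =>
    intro ρ hρ
    -- The induction hypothesis is needed at the modified substitution that acts below the
    -- quantifier.
    obtain ⟨ψ, hψ, hα⟩ := ih (ρ := setVar ρ x (Fm.var (freshFor ρ (Fm.all x φ hφ).ob)))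
      (Fm.gs_ids_of_normal_setVar hρ rfl)
    rw [Fm.gs_all]
    exact ⟨_, .gen (hα.mem_fvar (Fm.mem_fvar_gs_setVar hφ _ _)) hψ, .all _ _ hα⟩

end Ax

namespace Derives

variable {K : Type u} {L : Type v} {s : Sys} {Φ Ψ : Set (Fm K)} {φ ψ χ : Fm K}

open Fm (seq)

theorem trans (h : ∀ χ ∈ Φ, Derives s Ψ χ) (hφ : Derives s Φ φ) : Derives s Ψ φ := by
  induction hφ with
  | hyp hφ => exact h _ hφ
  | ax hφ => exact .ax hφ
  | an hφ => exact .an hφ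
  | mp _ _ ih1 ih2 => exact .mp ih1 ih2

theorem mono (h : Φ ⊆ Ψ) (hφ : Derives s Φ φ) : Derives s Ψ φ := trans (fun _ hχ => .hyp (h hχ)) hφ

theorem exists_finset (hφ : Derives s Φ φ) : ∃ F : Set (Fm K), F.Finite ∧ F ⊆ Φ ∧
    Derives s F φ := by
  induction hφ with
  | @hyp φ hφ => exact ⟨{φ}, Set.finite_singleton _, by simpa using hφ, .hyp rfl⟩
  | ax hφ => exact ⟨∅, Set.finite_empty, Set.empty_subset _, .ax hφ⟩
  | an hφ => exact ⟨∅, Set.finite_empty, Set.empty_subset _, .an hφ⟩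
  | mp _ _ ih1 ih2 =>
    obtain ⟨F, hF, hFΦ, h⟩ := ih1
    obtain ⟨G, hG, hGΦ, h'⟩ := ih2
    exact ⟨F ∪ G, hF.union hG, Set.union_subset hFΦ hGΦ,
      .mp (h.mono Set.subset_union_left) (h'.mono Set.subset_union_right)⟩

theorem taut {p : PropFm} (hp : p.IsTautology) (φ ψ χ : Fm K) :
    Derives s Φ (p.inst (seq φ ψ χ)) := .ax (.taut hp _)

theorem imp_self : Derives s Φ (.imp φ φ) :=
  taut (p := .imp (.var 0) (.var 0)) (fun _ h => h) φ φ φ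

theorem imp_const (h : Derives s Φ ψ) : Derives s Φ (.imp φ ψ) :=
  .mp h (taut (p := .imp (.var 0) (.imp (.var 1) (.var 0))) (fun _ h _ => h) ψ φ φ)

theorem imp_mp (h : Derives s Φ (.imp χ φ)) (h' : Derives s Φ (.imp χ (.imp φ ψ))) :
    Derives s Φ (.imp χ ψ) :=
  .mp h' (.mp h (taut (p := .imp (.imp (.var 2) (.var 0))
    (.imp (.imp (.var 2) (.imp (.var 0) (.var 1))) (.imp (.var 2) (.var 1))))
    (fun _ h h' h0 => h' h0 (h h0)) φ ψ χ))

theorem deduction (h : Derives s (insert χ Φ) φ) : Derives s Φ (.imp χ φ) := by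
  induction h with
  | hyp h =>
    rcases h with rfl | h
    · exact imp_self
    · exact imp_const (.hyp h)
  | ax h => exact imp_const (.ax h)
  | an h => exact imp_const (.an h)
  | mp _ _ ih1 ih2 => exact imp_mp ih1 ih2

theorem neg_of_imp_bot (h : Derives s Φ (.imp φ .bot)) : Derives s Φ (.neg φ) :=
  .mp h (taut (p := .imp (.imp (.var 0) .bot) (.neg (.var 0))) (fun _ h => h) φ φ φ)

theorem of_neg_imp_bot (h : Derives s Φ (.imp (.neg φ) .bot)) : Derives s Φ φ :=
  .mp h (taut (p := .imp (.imp (.neg (.var 0)) .bot) (.var 0))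
    (fun _ h => Classical.by_contradiction h) φ φ φ)

theorem bot_of_neg (h : Derives s Φ φ) (h' : Derives s Φ (.neg φ)) : Derives s Φ .bot :=
  .mp h' (.mp h (taut (p := .imp (.var 0) (.imp (.neg (.var 0)) .bot)) (fun _ h h' => h' h) φ φ φ))

theorem imp_of_neg (h : Derives s Φ (.neg φ)) : Derives s Φ (.imp φ ψ) :=
  .mp h (taut (p := .imp (.neg (.var 0)) (.imp (.var 0) (.var 1))) (fun _ h h' => absurd h' h) φ ψ ψ)

theorem of_neg_imp_left (h : Derives s Φ (.neg (.imp φ ψ))) : Derives s Φ φ :=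
  .mp h (taut (p := .imp (.neg (.imp (.var 0) (.var 1))) (.var 0))
    (fun _ h => Classical.by_contradiction fun h' => h fun h0 => absurd h0 h') φ ψ ψ)

theorem of_neg_imp_right (h : Derives s Φ (.neg (.imp φ ψ))) : Derives s Φ (.neg ψ) :=
  .mp h (taut (p := .imp (.neg (.imp (.var 0) (.var 1))) (.neg (.var 1)))
    (fun _ h h1 => h fun _ => h1) φ ψ ψ)

theorem of_eqv (h : Derives s Φ (.eqv φ ψ)) (hφ : Derives s Φ φ) : Derives s Φ ψ :=
  .mp hφ (.mp h (.ax (.eqvImp _ _)))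

theorem of_alpha (h : Fm.Alpha φ ψ) (hφ : Derives s Φ φ) : Derives s Φ ψ :=
  of_eqv (.ax (.alpha h)) hφ

/-- Derivations are closed under substitution for variables and constants. -/
theorem gs {ρ : ℕ ⊕ K → Fm L} (hρ : ∀ p, (ρ p).gs Fm.ids = ρ p) (h : Derives s Φ φ) :
    Derives s ((fun χ => χ.gs ρ) '' Φ) (φ.gs ρ) := by
  induction h with
  | hyp h => exact .hyp ⟨_, h, rfl⟩
  | ax h =>
    obtain ⟨ψ, hψ, hα⟩ := h.exists_alpha_gs hρ
    exact of_alpha hα.symm (.ax hψ)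
  | an h =>
    obtain ⟨ψ, hψ, hα⟩ := h.exists_alpha_gs hρ
    exact of_alpha hα.symm.box (.an hψ)
  | mp _ _ ih1 ih2 => exact .mp ih1 ih2

/-- Generalization is built into the axioms and passes through Modus Ponens by distribution of `∀`.
A necessitated axiom `□φ` is reached from `□∀xφ` by the converse Barcan formula. -/
theorem gen {x : ℕ} (hΦ : ∀ χ ∈ Φ, x ∉ χ.fvar) (h : Derives s Φ φ) :
    ∀ hx : x ∈ φ.fvar, Derives s Φ (.all x φ hx) := by
  induction h with
  | hyp h => intro hx; exact absurd hx (hΦ _ h)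
  | ax h => intro hx; exact .ax (.gen hx h)
  | @an φ h =>
    intro hx
    have hx' : x ∈ φ.fvar := hx
    exact .mp (.an (.gen hx' h)) (.ax (.barcanConv hx' hx))
  | @mp φ ψ h h' ih1 ih2 =>
    intro hx
    have hx' : x ∈ (Fm.imp φ ψ).fvar := Fm.mem_fvar_imp.2 (.inr hx)
    -- Without vacuous quantifiers, `∀ x φ` does not exist when `x` is not free in the minor
    -- premise; `allImpRight` covers that case.
    by_cases hφ : x ∈ φ.fvar
    · exact .mp (ih1 hφ) (.mp (ih2 hx') (.ax (.allImp _ _ _)))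
    · exact .mp h (.mp (ih2 hx') (.ax (.allImpRight _ hφ _)))

/-- Generalization on a constant that does not occur in the premises. -/
theorem gen_const {x : ℕ} {c : K} (hΦ : ∀ χ ∈ Φ, .inr c ∉ χ.ob) (hφ : .inr c ∉ φ.ob)
    (hx : x ∈ φ.fvar) (h : Derives s Φ (φ.subst₁ x (.const c))) : Derives s Φ (.all x φ hx) := by
  classical
  -- `Φ` may use up all variables; a finite part of it leaves a fresh `y`, which then takes the
  -- place of `c`.
  obtain ⟨F, hF, hFΦ, h⟩ := h.exists_finset
  refine mono hFΦ ?_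
  obtain ⟨y, hy⟩ := Infinite.exists_notMem_finset (hF.toFinset.biUnion Fm.fvar ∪ φ.fvar)
  simp only [Finset.mem_union, Finset.mem_biUnion, Set.Finite.mem_toFinset, not_or, not_exists,
    not_and] at hy
  let ρ : ℕ ⊕ K → Fm K := Function.update Fm.ids (.inr c) (.var y)
  have hρ_ne : ∀ p, p ≠ .inr c → ρ p = Fm.ids p := fun p hp => Function.update_of_ne hp _ _
  have hρ : ∀ p, (ρ p).gs Fm.ids = ρ p := by
    intro p
    by_cases hp : p = .inr c
    · subst hp; simp only [ρ, Function.update_self]; rfl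
    · rw [hρ_ne p hp, Fm.ids_gs]
  have hfix : ∀ χ : Fm K, .inr c ∉ χ.ob → χ.gs ρ = χ.gs Fm.ids := by
    intro χ hχ
    exact Fm.gs_congr fun p hp => hρ_ne p fun h => hχ (h ▸ hp)
  have hsub : (φ.subst₁ x (.const c)).gs ρ = φ.subst₁ x (.var y) := by
    rw [Fm.subst₁_gs, Fm.subst₁_eq_gs, Fm.gs_const]
    apply Fm.gs_congr
    intro p hp
    by_cases hpx : p = .inl x
    · subst hpx; simp [ρ]
    · rw [setVar_of_ne _ _ _ hpx, setVar_of_ne _ _ _ hpx]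
      exact hρ_ne p fun h => hφ (h ▸ hp)
  have h1 : Derives s F (φ.subst₁ x (.var y)) := by
    rw [← hsub]
    -- The premises do not contain `c`, so the replacement only brings them into normal form, and
    -- they stay derivable from `F`.
    refine trans ?_ (h.gs hρ)
    rintro _ ⟨χ, hχ, rfl⟩
    show Derives s F (χ.gs ρ)
    rw [hfix χ (hΦ χ (hFΦ hχ))]
    exact of_alpha (.gs_ids χ) (.hyp hχ)
  have hymem : y ∈ (φ.subst₁ x (.var y)).fvar := by
    rw [Fm.subst₁_eq_gs]; exact Fm.mem_fvar_gs_setVar hx _ _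
  exact of_alpha (Fm.Alpha.rename hx (fun h => hy.2 (Fm.mem_fvar_all.1 h).2) hymem).symm
    (h1.gen hy.1 hymem)

end Derives

end NFL

namespace NFL

/-! ## Soundness -/

namespace PropFm

variable {B : Type w} [BooleanAlgebra B]

/-- The value of a propositional formula in a Boolean algebra. -/
def val (v : ℕ → B) : PropFm → B
  | var x => v x
  | bot => ⊥
  | top => ⊤
  | neg φ => (val v φ)ᶜ
  | imp φ ψ => val v φ ⇨ val v ψ
  | or φ ψ => val v φ ⊔ val v ψ
  | and φ ψ => val v φ ⊓ val v ψ

/-- The quotient by a prime ideal is the two-element algebra, so lying outside the ideal is a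
classical valuation. -/
theorem holds_iff_val_notMem (v : ℕ → B) (J : Order.Ideal B) [hJ : J.IsPrime] (p : PropFm) :
    p.Holds (fun x => v x ∉ J) ↔ p.val v ∉ J := by
  have hcompl : ∀ a : B, aᶜ ∈ J ↔ a ∉ J := by
    intro a
    refine ⟨fun h h' => hJ.toIsProper.top_notMem ?_, fun h => (hJ.mem_or_compl_mem).resolve_left h⟩
    rw [← sup_compl_eq_top (x := a)]
    exact Order.Ideal.sup_mem h' h
  induction p with
  | var x => rfl
  | bot => simp [Holds, val]
  | top => simpa [Holds, val] using hJ.toIsProper.top_notMem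
  | neg p ih => simp only [Holds, val, hcompl, ih]
  | imp p q ih1 ih2 =>
    simp only [Holds, val, himp_eq, Order.Ideal.sup_mem_iff, hcompl, ih1, ih2]
    tauto
  | or p q ih1 ih2 =>
    simp only [Holds, val, Order.Ideal.sup_mem_iff, ih1, ih2]
    tauto
  | and p q ih1 ih2 =>
    have : p.val v ⊓ q.val v ∈ J ↔ p.val v ∈ J ∨ q.val v ∈ J :=
      ⟨fun h => hJ.mem_or_mem h, fun h => h.elim (fun h => J.lower inf_le_left h)
        fun h => J.lower inf_le_right h⟩
    simp only [Holds, val, this, ih1, ih2]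
    tauto

/-- A value other than `⊤` lies in some prime ideal, and the associated two-valued valuation would
falsify `p`. -/
theorem IsTautology.val_eq_top {p : PropFm} (hp : p.IsTautology) (v : ℕ → B) : p.val v = ⊤ := by
  by_contra hne
  obtain ⟨J, hJ, hle, -⟩ := DistribLattice.prime_ideal_of_disjoint_filter_ideal
    (F := Order.PFilter.principal (⊤ : B)) (I := Order.Ideal.principal (p.val v)) (by
      rw [Set.disjoint_left]
      intro a ha ha'
      have h1 : ⊤ ≤ a := ha
      have h2 : a ≤ p.val v := ha'
      exact hne (top_le_iff.1 (h1.trans h2)))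
  have : J.IsPrime := hJ
  exact (holds_iff_val_notMem v J p).1 (hp _) (hle (Order.Ideal.mem_principal_self))

end PropFm

namespace PropDomain

variable {K : Type u} {L : Type v} {M : Type w}

/-- The propositional domain `D` with the constants interpreted by `G`. -/
def withGam (D : PropDomain L M) (G : K → M) : PropDomain K M :=
  ⟨D.TRUE, D.NEC, D.fbot, D.ftop, D.fbox, D.fneg, D.fdisj, D.fconj, D.fimp, D.feqv, D.fall, G⟩

theorem evalPre_congr (D : PropDomain L M) (φ : PreFm K) : ∀ {γ γ' : ℕ → M} {G G' : K → M},
    (∀ p ∈ φ.ob, Sum.elim γ G p = Sum.elim γ' G' p) →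
    (D.withGam G).evalPre φ γ = (D.withGam G').evalPre φ γ' := by
  induction φ with
  | var x => intro γ γ' G G' h; exact h (.inl x) (by simp [PreFm.ob])
  | const c => intro γ γ' G G' h; exact h (.inr c) (by simp [PreFm.ob])
  | bot | top => intros; rfl
  | neg φ ih | box φ ih => intro γ γ' G G' h; simp only [evalPre]; rw [ih h]; rfl
  | imp φ ψ ih1 ih2 | or φ ψ ih1 ih2 | and φ ψ ih1 ih2 | eqv φ ψ ih1 ih2 =>
    intro γ γ' G G' h
    simp only [evalPre]
    rw [ih1 fun p hp => h p (by simp [PreFm.ob, hp]), ih2 fun p hp => h p (by simp [PreFm.ob, hp])]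
    rfl
  | all x φ ih =>
    intro γ γ' G G' h
    refine congrArg D.fall (funext fun m => ih fun p hp => ?_)
    rcases p with y | k
    · by_cases hy : y = x
      · subst hy; simp
      · have := h (.inl y) (PreFm.mem_ob_all.2 ⟨by simpa using hy, hp⟩)
        simpa [hy] using this
    · exact h (.inr k) (PreFm.mem_ob_all.2 ⟨by simp, hp⟩)

theorem evalPre_congr_var (D : PropDomain K M) (φ : PreFm K) {γ γ' : ℕ → M}
    (h : ∀ x ∈ φ.fvar, γ x = γ' x) : D.evalPre φ γ = D.evalPre φ γ' := by
  refine D.evalPre_congr φ (G := D.Gam) (G' := D.Gam) fun p hp => ?_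
  rcases p with x | k
  · exact h x ((PreFm.inl_mem_ob _).1 hp)
  · rfl

/-- The substitution lemma. As `ρ` also replaces constants, possibly by formulas of another
language, their interpretation has to change along with the assignment. -/
theorem evalPre_gs (D : PropDomain L M) (φ : PreFm K) : ∀ (ρ : ℕ ⊕ K → PreFm L) (γ : ℕ → M),
    D.evalPre (φ.gs ρ) γ = (D.withGam fun k => D.evalPre (ρ (.inr k)) γ).evalPre φ
      fun x => D.evalPre (ρ (.inl x)) γ := by
  induction φ with
  | var x | const c | bot | top => intros; rfl
  | neg φ ih | box φ ih => intro ρ γ; simp only [evalPre, PreFm.gs]; rw [ih]; rfl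
  | imp φ ψ ih1 ih2 | or φ ψ ih1 ih2 | and φ ψ ih1 ih2 | eqv φ ψ ih1 ih2 =>
    intro ρ γ; simp only [evalPre, PreFm.gs]; rw [ih1, ih2]; rfl
  | all x φ ih =>
    intro ρ γ
    refine congrArg D.fall (funext fun m => ?_)
    rw [ih]
    refine D.evalPre_congr φ fun p hp => ?_
    have hfresh : ∀ p ∈ φ.ob, p ≠ .inl x → D.evalPre (ρ p)
        (Function.update γ (PreFm.freshFor ρ (PreFm.all x φ).ob) m) = D.evalPre (ρ p) γ := by
      intro p hp hpx
      apply evalPre_congr_var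
      intro y hy
      apply Function.update_of_ne
      rintro rfl
      exact PreFm.freshFor_notMem (PreFm.mem_ob_all.2 ⟨hpx, hp⟩) hy
    rcases p with y | k
    · by_cases hy : y = x
      · subst hy; simp [evalPre]
      · have hne : (.inl y : ℕ ⊕ K) ≠ .inl x := by simpa using hy
        simp only [Sum.elim_inl, setVar_of_ne _ _ _ hne, Function.update_of_ne hy]
        exact hfresh _ hp hne
    · exact hfresh _ hp (by simp)

variable (D : PropDomain K M)

theorem eval_congr (φ : Fm K) {γ γ' : ℕ → M} (h : ∀ x ∈ φ.fvar, γ x = γ' x) :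
    D.eval γ φ = D.eval γ' φ := D.evalPre_congr_var φ.1 h

theorem eval_gs (D : PropDomain L M) (φ : Fm K) (ρ : ℕ ⊕ K → Fm L) (γ : ℕ → M) :
    D.eval γ (φ.gs ρ) = (D.withGam fun k => D.eval γ (ρ (.inr k))).eval
      (fun x => D.eval γ (ρ (.inl x))) φ := D.evalPre_gs φ.1 _ γ

theorem eval_subst₁ (γ : ℕ → M) (φ : Fm K) (x : ℕ) (ψ : Fm K) :
    D.eval γ (φ.subst₁ x ψ) = D.eval (Function.update γ x (D.eval γ ψ)) φ := by
  rw [Fm.subst₁_eq_gs, eval_gs]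
  refine D.evalPre_congr φ.1 (G' := D.Gam) fun p _ => ?_
  rcases p with y | k
  · by_cases hy : y = x
    · subst hy; simp
    · have hne : (.inl y : ℕ ⊕ K) ≠ .inl x := by simpa using hy
      simp only [Sum.elim_inl, setVar_of_ne _ _ _ hne, Function.update_of_ne hy]
      rfl
  · rfl

theorem eval_eq_of_alpha {φ ψ : Fm K} (h : Fm.Alpha φ ψ) :
    ∀ γ : ℕ → M, D.eval γ φ = D.eval γ ψ := by
  induction h with
  | @rename x y φ hx hy hy' =>
    intro γ
    refine congrArg D.fall (funext fun m => ?_)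
    show D.eval _ φ = D.eval _ (φ.subst₁ x (.var y))
    rw [eval_subst₁]
    apply eval_congr
    intro z hz
    by_cases hzx : z = x
    · subst hzx; simp [eval, Fm.var, evalPre]
    · have hzy : z ≠ y := by
        rintro rfl
        exact hy (Fm.mem_fvar_all.2 ⟨hzx, hz⟩)
      simp [hzx, hzy]
  | refl φ => intro γ; rfl
  | symm _ ih => intro γ; exact (ih γ).symm
  | trans _ _ ih1 ih2 => intro γ; exact (ih1 γ).trans (ih2 γ)
  | neg _ ih => intro γ; exact congrArg D.fneg (ih γ)
  | box _ ih => intro γ; exact congrArg D.fbox (ih γ)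
  | imp _ _ ih1 ih2 => intro γ; exact congrArg₂ D.fimp (ih1 γ) (ih2 γ)
  | or _ _ ih1 ih2 => intro γ; exact congrArg₂ D.fdisj (ih1 γ) (ih2 γ)
  | and _ _ ih1 ih2 => intro γ; exact congrArg₂ D.fconj (ih1 γ) (ih2 γ)
  | eqv _ _ ih1 ih2 => intro γ; exact congrArg₂ D.feqv (ih1 γ) (ih2 γ)
  | all hx hx' _ ih => intro γ; exact congrArg D.fall (funext fun m => ih _)

variable {D} {s : Sys}

namespace IsNormalModel

theorem isS3Model (h : D.IsNormalModel s) : D.IsS3Model := by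
  cases s
  exacts [h.1, h.1.1, h.1.1.1]

theorem nec_nonempty (h : D.IsNormalModel s) : D.NEC.Nonempty := by
  cases s
  exacts [h.2, h.1.2, h.1.1.2]

theorem box_box (h : D.IsNormalModel s) (hs : s = .S4 ∨ s = .S5) (a : M) :
    D.le (D.fbox a) (D.fbox (D.fbox a)) := by
  rcases hs with rfl | rfl
  exacts [h.2 a, h.1.2 a]

theorem mem_nec_of_top_le (h : D.IsNormalModel s) {a : M} (ha : D.le D.ftop a) : a ∈ D.NEC := by
  have hF := h.isS3Model.nec_filter h.nec_nonempty
  refine hF.up _ _ ?_ ha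
  obtain ⟨b, hb⟩ := h.nec_nonempty
  obtain ⟨_, q, -, hle, -, htop, -⟩ := (h.isS3Model.prealgebra h.nec_nonempty).quotient
  refine hF.up _ _ hb ((hle _ _).1 ?_)
  rw [htop]
  exact le_top

theorem eval_inst_mem_nec (h : D.IsNormalModel s) {p : PropFm} (hp : p.IsTautology)
    (σ : ℕ → Fm K) (γ : ℕ → M) : D.eval γ (p.inst σ) ∈ D.NEC := by
  obtain ⟨_, q, -, hle, hbot, htop, hneg, hor, hand, himp⟩ :=
    (h.isS3Model.prealgebra h.nec_nonempty).quotient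
  have key : ∀ p : PropFm, q (D.eval γ (p.inst σ)) = p.val fun x => q (D.eval γ (σ x)) := by
    intro p
    induction p with
    | var x => rfl
    | bot => exact hbot
    | top => exact htop
    | neg p ih => exact (hneg _).trans (congrArg _ ih)
    | imp p r ih1 ih2 => exact (himp _ _).trans (congrArg₂ _ ih1 ih2)
    | or p r ih1 ih2 => exact (hor _ _).trans (congrArg₂ _ ih1 ih2)
    | and p r ih1 ih2 => exact (hand _ _).trans (congrArg₂ _ ih1 ih2)
  refine h.mem_nec_of_top_le ((hle _ _).1 ?_)
  rw [key, hp.val_eq_top]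
  exact le_top

/-- `NEC` rather than `TRUE`, so that the Axiom Necessitation rule is sound; all assignments at
once, so that `all_nec` applies to generalized axioms. -/
theorem eval_mem_nec (h : D.IsNormalModel s) {φ : Fm K} (hφ : Ax s φ) :
    ∀ γ : ℕ → M, D.eval γ φ ∈ D.NEC := by
  have ho := h.isS3Model.order h.nec_nonempty
  induction hφ with
  | taut hp σ => exact h.eval_inst_mem_nec hp σ
  | T φ => intro γ; exact ho.box_le _
  | distr φ ψ => intro γ; exact ho.box_imp _ _
  | distrBox φ ψ => intro γ; exact ho.box_imp_box _ _
  | @alpha φ ψ hα =>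
    intro γ
    show D.feqv (D.eval γ φ) (D.eval γ ψ) ∈ D.NEC
    rw [D.eval_eq_of_alpha hα]
    exact h.mem_nec_of_top_le (ho.eqv_refl _)
  | eqvImp φ ψ => intro γ; exact ho.eqv_imp _ _
  | @eqvSubst x φ hx ψ ψ' =>
    intro γ
    show D.le (D.feqv (D.eval γ ψ) (D.eval γ ψ'))
      (D.feqv (D.eval γ (φ.subst₁ x ψ)) (D.eval γ (φ.subst₁ x ψ')))
    rw [eval_subst₁, eval_subst₁]
    exact ho.eqv_subst _ _ (fun m => D.eval (Function.update γ x m) φ) ⟨φ, x, γ, hx, fun _ => rfl⟩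
  | @allEqv x φ ψ hx hφ hψ =>
    intro γ; exact ho.all_eqv φ ψ x γ _ _ ⟨hφ, fun _ => rfl⟩ ⟨hψ, fun _ => rfl⟩
  | @allInst x φ hφ ψ =>
    intro γ
    show D.le (D.eval γ (.all x φ hφ)) (D.eval γ (φ.subst₁ x ψ))
    rw [eval_subst₁]
    exact ho.all_le (fun m => D.eval (Function.update γ x m) φ) ⟨φ, x, γ, hφ, fun _ => rfl⟩ _
  | @allImp x φ ψ hx hφ hψ =>
    intro γ; exact ho.all_imp φ ψ x γ _ _ ⟨hφ, fun _ => rfl⟩ ⟨hψ, fun _ => rfl⟩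
  | @allImpRight x φ ψ hx hφ hψ =>
    intro γ
    have := ho.all_imp_right φ ψ x γ (fun m => D.eval (Function.update γ x m) ψ) hφ
      ⟨hψ, fun _ => rfl⟩
    have hconst : ∀ m, D.eval (Function.update γ x m) φ = D.eval γ φ := fun m =>
      D.eval_congr φ fun y hy => Function.update_of_ne (fun h' => hφ (by rwa [h'] at hy)) _ _
    have heq : (fun m => D.fimp (D.eval γ φ) (D.eval (Function.update γ x m) ψ)) =
        fun m => D.eval (Function.update γ x m) (.imp φ ψ) := by
      funext m
      rw [← hconst m]
      rfl
    rwa [heq] at this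
  | @barcanConv x φ hφ hx =>
    intro γ; exact (ho.box_all _ ⟨φ, x, γ, hφ, fun _ => rfl⟩).1
  | @barcan x φ hφ hx =>
    intro γ; exact (ho.box_all _ ⟨φ, x, γ, hφ, fun _ => rfl⟩).2
  | four hs φ => intro γ; exact h.box_box hs _
  | five hs φ => intro γ; subst hs; exact h.2 _
  | @gen x φ hφ _ ih =>
    intro γ
    exact ho.all_nec _ ⟨φ, x, γ, hφ, fun _ => rfl⟩ fun m => ih _

theorem sat_of_derives (h : D.IsNormalModel s) {Φ : Set (Fm K)} {φ : Fm K} (hφ : Derives s Φ φ)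
    {γ : ℕ → M} (hΦ : ∀ ψ ∈ Φ, D.Sat γ ψ) : D.Sat γ φ := by
  have ht := h.isS3Model.truth
  induction hφ with
  | hyp hφ => exact hΦ _ hφ
  | ax hφ => exact h.isS3Model.nec_subset h.nec_nonempty (h.eval_mem_nec hφ γ)
  | an hφ => exact (ht.box _).2 (h.eval_mem_nec hφ γ)
  | mp _ _ ih1 ih2 => exact ((ht.imp _ _).1 ih2).resolve_left fun h' => h' ih1

end IsNormalModel

end PropDomain

end NFL

namespace NFL

/-! ## The canonical model of a Henkin set -/

/-- The hypotheses are inequalities and closure rules for `le`, each of which a boxed tautology can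
deliver. Monotonicity makes the operations descend to the quotient. -/
theorem IsBooleanPrealgebra.of_le {M : Type w} {bot top : M} {neg : M → M} {or and imp : M → M → M}
    {le : M → M → Prop} (refl : ∀ a, le a a) (trans : ∀ a b c, le a b → le b c → le a c)
    (bot_le : ∀ a, le bot a) (le_top : ∀ a, le a top)
    (le_or_left : ∀ a b, le a (or a b)) (le_or_right : ∀ a b, le b (or a b))
    (or_le : ∀ a b c, le a c → le b c → le (or a b) c)
    (and_le_left : ∀ a b, le (and a b) a) (and_le_right : ∀ a b, le (and a b) b)
    (le_and : ∀ a b c, le a b → le a c → le a (and b c))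
    (distrib : ∀ a b c, le (and (or a b) (or a c)) (or a (and b c)))
    (neg_anti : ∀ a b, le a b → le (neg b) (neg a))
    (and_neg_le : ∀ a, le (and a (neg a)) bot) (le_or_neg : ∀ a, le top (or a (neg a)))
    (imp_le : ∀ a b, le (imp a b) (or b (neg a))) (le_imp : ∀ a b, le (or b (neg a)) (imp a b)) :
    IsBooleanPrealgebra bot top neg or and imp le := by
  have or_mono : ∀ a a' b b', le a a' → le b b' → le (or a b) (or a' b') := fun a a' b b' h h' =>
    or_le _ _ _ (trans _ _ _ h (le_or_left _ _)) (trans _ _ _ h' (le_or_right _ _))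
  have and_mono : ∀ a a' b b', le a a' → le b b' → le (and a b) (and a' b') :=
    fun a a' b b' h h' =>
    le_and _ _ _ (trans _ _ _ (and_le_left _ _) h) (trans _ _ _ (and_le_right _ _) h')
  have imp_mono : ∀ a a' b b', le a' a → le b b' → le (imp a b) (imp a' b') :=
    fun a a' b b' h h' => trans _ _ _ (imp_le _ _)
      (trans _ _ _ (or_mono _ _ _ _ h' (neg_anti _ _ h)) (le_imp _ _))
  refine ⟨refl, trans, fun a a' h => ⟨neg_anti _ _ h.2, neg_anti _ _ h.1⟩,
    fun a a' b b' h h' => ⟨or_mono _ _ _ _ h.1 h'.1, or_mono _ _ _ _ h.2 h'.2⟩,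
    fun a a' b b' h h' => ⟨and_mono _ _ _ _ h.1 h'.1, and_mono _ _ _ _ h.2 h'.2⟩,
    fun a a' b b' h h' => ⟨imp_mono _ _ _ _ h.2 h'.1, imp_mono _ _ _ _ h.1 h'.2⟩, ?_⟩
  let S := preSetoid le refl trans
  let le' : Quotient S → Quotient S → Prop := Quotient.lift₂ le fun a b a' b' h h' =>
    propext ⟨fun h0 => trans _ _ _ h.2 (trans _ _ _ h0 h'.1),
      fun h0 => trans _ _ _ h.1 (trans _ _ _ h0 h'.2)⟩
  let or' : Quotient S → Quotient S → Quotient S := Quotient.map₂ or fun a a' h b b' h' =>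
    ⟨or_mono _ _ _ _ h.1 h'.1, or_mono _ _ _ _ h.2 h'.2⟩
  let and' : Quotient S → Quotient S → Quotient S := Quotient.map₂ and fun a a' h b b' h' =>
    ⟨and_mono _ _ _ _ h.1 h'.1, and_mono _ _ _ _ h.2 h'.2⟩
  let imp' : Quotient S → Quotient S → Quotient S := Quotient.map₂ imp fun a a' h b b' h' =>
    ⟨imp_mono _ _ _ _ h.2 h'.1, imp_mono _ _ _ _ h.1 h'.2⟩
  let neg' : Quotient S → Quotient S := Quotient.map neg fun a a' h =>
    ⟨neg_anti _ _ h.2, neg_anti _ _ h.1⟩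
  let B : BooleanAlgebra (Quotient S) :=
    { le := le'
      sup := or'
      inf := and'
      himp := imp'
      compl := neg'
      sdiff := fun a b => and' a (neg' b)
      top := Quotient.mk _ top
      bot := Quotient.mk _ bot
      le_refl := fun a => Quotient.inductionOn a refl
      le_trans := fun a b c => Quotient.inductionOn₃ a b c trans
      le_antisymm := fun a b => Quotient.inductionOn₂ a b fun _ _ h h' => Quotient.sound ⟨h, h'⟩
      le_sup_left := fun a b => Quotient.inductionOn₂ a b le_or_left
      le_sup_right := fun a b => Quotient.inductionOn₂ a b le_or_right
      sup_le := fun a b c => Quotient.inductionOn₃ a b c or_le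
      inf_le_left := fun a b => Quotient.inductionOn₂ a b and_le_left
      inf_le_right := fun a b => Quotient.inductionOn₂ a b and_le_right
      le_inf := fun a b c => Quotient.inductionOn₃ a b c le_and
      le_sup_inf := fun a b c => Quotient.inductionOn₃ a b c distrib
      le_top := fun a => Quotient.inductionOn a le_top
      bot_le := fun a => Quotient.inductionOn a bot_le
      inf_compl_le_bot := fun a => Quotient.inductionOn a and_neg_le
      top_le_sup_compl := fun a => Quotient.inductionOn a le_or_neg
      sdiff_eq := fun _ _ => rfl
      himp_eq := fun a b => Quotient.inductionOn₂ a b fun _ _ =>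
        Quotient.sound ⟨imp_le _ _, le_imp _ _⟩ }
  exact ⟨B, Quotient.mk _, rfl, fun _ _ => Iff.rfl, rfl, rfl, fun _ => rfl, fun _ _ => rfl,
    fun _ _ => rfl, fun _ _ => rfl⟩

namespace Fm

variable {K : Type u}

theorem subst₁_of_notMem {φ : Fm K} {x : ℕ} (hx : x ∉ φ.fvar) (ψ : Fm K) :
    φ.subst₁ x ψ = φ.gs ids := by
  rw [subst₁_eq_gs]
  apply gs_congr
  intro p hp
  apply setVar_of_ne
  rintro rfl
  exact hx ((inl_mem_ob _).1 hp)

theorem subst₁_subst₁ {φ : Fm K} {x y : ℕ} (hy : y ∉ φ.fvar) (ψ : Fm K) :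
    (φ.subst₁ x (var y)).subst₁ y ψ = φ.subst₁ x ψ := by
  rw [subst₁_eq_gs φ, subst₁_eq_gs φ, gs_setVar_subst₁]
  · simp only [ids_gs]
  · intro p hp _ h
    have := mem_ob_ids.1 ((inl_mem_ob _).2 h)
    exact hy ((inl_mem_ob _).1 (this ▸ hp))

theorem subst₁_var_self (x : ℕ) (ψ : Fm K) : (var x).subst₁ x ψ = ψ := by
  rw [subst₁_eq_gs, gs_var, setVar_same]

theorem subst₁_neg (φ : Fm K) (x : ℕ) (χ : Fm K) :
    (neg φ).subst₁ x χ = neg (φ.subst₁ x χ) := rfl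

theorem subst₁_box (φ : Fm K) (x : ℕ) (χ : Fm K) :
    (box φ).subst₁ x χ = box (φ.subst₁ x χ) := rfl

theorem subst₁_imp (φ ψ : Fm K) (x : ℕ) (χ : Fm K) :
    (imp φ ψ).subst₁ x χ = imp (φ.subst₁ x χ) (ψ.subst₁ x χ) := rfl

theorem subst₁_eqv (φ ψ : Fm K) (x : ℕ) (χ : Fm K) :
    (eqv φ ψ).subst₁ x χ = eqv (φ.subst₁ x χ) (ψ.subst₁ x χ) := rfl

end Fm

/-! ### Provable identity as a congruence -/

namespace Derives

variable {K : Type u} {s : Sys} {Φ : Set (Fm K)} {φ φ' ψ ψ' χ : Fm K}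

theorem eqv_of_alpha (h : Fm.Alpha φ ψ) : Derives s Φ (.eqv φ ψ) := .ax (.alpha h)

theorem eqv_subst₁ (h : Derives s Φ (.eqv ψ ψ')) {x : ℕ} (hx : x ∈ φ.fvar) :
    Derives s Φ (.eqv (φ.subst₁ x ψ) (φ.subst₁ x ψ')) := .mp h (.ax (.eqvSubst hx _ _))

/-- No axiom states symmetry or transitivity; both come from replacing `x` in `x ≡ ψ`, with `x`
fresh. The substitution normalizes `ψ`, which alpha-congruence undoes. -/
theorem eqv_left (h : Derives s Φ (.eqv φ φ')) (h' : Derives s Φ (.eqv φ ψ)) :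
    Derives s Φ (.eqv φ' ψ) := by
  obtain ⟨x, hx⟩ := Infinite.exists_notMem_finset ψ.fvar
  have := h.eqv_subst₁ (φ := .eqv (.var x) ψ)
    (Fm.mem_fvar_eqv.2 (.inl (Fm.mem_fvar_var.2 rfl)))
  simp only [Fm.subst₁_eqv, Fm.subst₁_var_self, Fm.subst₁_of_notMem hx] at this
  exact of_alpha (.eqv (.refl _) (.symm (.gs_ids ψ)))
    (of_eqv this (of_alpha (.eqv (.refl _) (.gs_ids ψ)) h'))

theorem eqv_symm (h : Derives s Φ (.eqv φ ψ)) : Derives s Φ (.eqv ψ φ) :=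
  eqv_left h (eqv_of_alpha (.refl _))

theorem eqv_trans (h : Derives s Φ (.eqv φ ψ)) (h' : Derives s Φ (.eqv ψ χ)) :
    Derives s Φ (.eqv φ χ) := eqv_left h.eqv_symm h'

theorem eqv_neg (h : Derives s Φ (.eqv φ ψ)) : Derives s Φ (.eqv (.neg φ) (.neg ψ)) := by
  have := h.eqv_subst₁ (φ := .neg (.var 0)) (x := 0) (Fm.mem_fvar_var (K := K).2 rfl)
  simpa only [Fm.subst₁_neg, Fm.subst₁_var_self] using this

theorem eqv_box (h : Derives s Φ (.eqv φ ψ)) : Derives s Φ (.eqv (.box φ) (.box ψ)) := by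
  have := h.eqv_subst₁ (φ := .box (.var 0)) (x := 0) (Fm.mem_fvar_var (K := K).2 rfl)
  simpa only [Fm.subst₁_box, Fm.subst₁_var_self] using this

/-- The identity `≡` is a congruence for each binary connective `op`. -/
theorem eqv_congr₂ (op : Fm K → Fm K → Fm K)
    (hfvar : ∀ φ ψ x, x ∈ φ.fvar ∨ x ∈ ψ.fvar → x ∈ (op φ ψ).fvar)
    (hsubst : ∀ φ ψ x χ, (op φ ψ).subst₁ x χ = op (φ.subst₁ x χ) (ψ.subst₁ x χ))
    (halpha : ∀ {φ φ' ψ ψ'}, Fm.Alpha φ φ' → Fm.Alpha ψ ψ' → Fm.Alpha (op φ ψ) (op φ' ψ'))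
    (h : Derives s Φ (.eqv φ φ')) (h' : Derives s Φ (.eqv ψ ψ')) :
    Derives s Φ (.eqv (op φ ψ) (op φ' ψ')) := by
  obtain ⟨x, hx⟩ := Infinite.exists_notMem_finset ψ.fvar
  obtain ⟨y, hy⟩ := Infinite.exists_notMem_finset φ'.fvar
  have h1 := h.eqv_subst₁ (φ := op (.var x) ψ) (hfvar _ _ x (.inl (Fm.mem_fvar_var.2 rfl)))
  have h2 := h'.eqv_subst₁ (φ := op φ' (.var y)) (hfvar _ _ y (.inr (Fm.mem_fvar_var.2 rfl)))
  simp only [hsubst, Fm.subst₁_var_self, Fm.subst₁_of_notMem hx, Fm.subst₁_of_notMem hy] at h1 h2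
  exact eqv_trans
    (of_alpha (.eqv (halpha (.refl _) (.symm (.gs_ids ψ))) (halpha (.refl _) (.symm (.gs_ids ψ)))) h1)
    (of_alpha (.eqv (halpha (.symm (.gs_ids φ')) (.refl _)) (halpha (.symm (.gs_ids φ')) (.refl _))) h2)

theorem box_mp (h : Derives s Φ (.box φ)) (h' : Derives s Φ (.box (.imp φ ψ))) :
    Derives s Φ (.box ψ) := .mp h (.mp h' (.ax (.distr _ _)))

theorem box_taut {p : PropFm} (hp : p.IsTautology) (φ ψ χ : Fm K) :
    Derives s Φ (.box (p.inst (Fm.seq φ ψ χ))) := .an (.taut hp _)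

end Derives

/-! ### Henkin sets decide formulas classically -/

namespace IsHenkin

variable {K : Type u} {s : Sys} {Φ : Set (Fm K)} {φ ψ : Fm K}

theorem derives_or_neg (h : IsHenkin s Φ) (φ : Fm K) : Derives s Φ φ ∨ Derives s Φ (.neg φ) := by
  by_cases hc : Consistent s (insert φ Φ)
  · left
    have := h.maximal _ hc (Set.subset_insert _ _)
    exact .hyp (this ▸ Set.mem_insert _ _)
  · right
    exact .neg_of_imp_bot (Derives.deduction (not_not.1 hc))

theorem derives_neg (h : IsHenkin s Φ) : Derives s Φ (.neg φ) ↔ ¬ Derives s Φ φ :=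
  ⟨fun h1 h2 => h.consistent (h2.bot_of_neg h1), fun h1 => (h.derives_or_neg φ).resolve_left h1⟩

theorem derives_imp (h : IsHenkin s Φ) :
    Derives s Φ (.imp φ ψ) ↔ ¬ Derives s Φ φ ∨ Derives s Φ ψ := by
  constructor
  · intro h1
    by_cases h2 : Derives s Φ φ
    · exact .inr (.mp h2 h1)
    · exact .inl h2
  · rintro (h1 | h1)
    · exact (h.derives_neg.2 h1).imp_of_neg
    · exact h1.imp_const

theorem derives_and : Derives s Φ (.and φ ψ) ↔ Derives s Φ φ ∧ Derives s Φ ψ := by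
  constructor
  · intro h
    exact ⟨.mp h (.taut (p := .imp (.and (.var 0) (.var 1)) (.var 0)) (fun _ h => h.1) φ ψ ψ),
      .mp h (.taut (p := .imp (.and (.var 0) (.var 1)) (.var 1)) (fun _ h => h.2) φ ψ ψ)⟩
  · rintro ⟨h1, h2⟩
    exact .mp h2 (.mp h1 (.taut (p := .imp (.var 0) (.imp (.var 1) (.and (.var 0) (.var 1))))
      (fun _ h h' => ⟨h, h'⟩) φ ψ ψ))

theorem derives_or (h : IsHenkin s Φ) :
    Derives s Φ (.or φ ψ) ↔ Derives s Φ φ ∨ Derives s Φ ψ := by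
  constructor
  · intro h1
    refine or_iff_not_imp_left.2 fun h2 => ?_
    exact .mp (h.derives_neg.2 h2) (.mp h1 (.taut
      (p := .imp (.or (.var 0) (.var 1)) (.imp (.neg (.var 0)) (.var 1)))
      (fun _ h h' => h.resolve_left h') φ ψ ψ))
  · rintro (h1 | h1)
    · exact .mp h1 (.taut (p := .imp (.var 0) (.or (.var 0) (.var 1))) (fun _ h => .inl h) φ ψ ψ)
    · exact .mp h1 (.taut (p := .imp (.var 1) (.or (.var 0) (.var 1))) (fun _ h => .inr h) φ ψ ψ)

end IsHenkin

section Canonical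

variable {K : Type u} {M : Type w} {s : Sys} {Φ : Set (Fm K)} {mk : Fm K → M} {out : M → Fm K}

/-- The function `t` on the set `M` of classes is represented by the formula `χ` with the
variable `z`. -/
def Represents (mk : Fm K → M) (z : ℕ) (χ : Fm K) (t : M → M) : Prop :=
  z ∈ χ.fvar ∧ ∀ ψ, t (mk ψ) = mk (χ.subst₁ z ψ)

open Classical in
/-- The domain of the formulas modulo the identity `≡` that is given by `Φ`; `mk` is the
quotient map, and `out` a choice of representatives. -/
noncomputable def canonicalDomain (s : Sys) (Φ : Set (Fm K)) (mk : Fm K → M) (out : M → Fm K) :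
    PropDomain K M where
  TRUE := {a | Derives s Φ (out a)}
  NEC := {a | Derives s Φ (.box (out a))}
  fbot := mk .bot
  ftop := mk .top
  fbox a := mk (.box (out a))
  fneg a := mk (.neg (out a))
  fdisj a b := mk (.or (out a) (out b))
  fconj a b := mk (.and (out a) (out b))
  fimp a b := mk (.imp (out a) (out b))
  feqv a b := mk (.eqv (out a) (out b))
  -- For a Henkin set the chosen representative is immaterial. The value `mk .bot` on the other
  -- functions is arbitrary, since no condition on models reaches a function that is not
  -- represented.
  fall t := if h : ∃ a : {p : ℕ × Fm K // p.1 ∈ p.2.fvar}, Represents mk a.1.1 a.1.2 t then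
    mk (.all h.choose.1.1 h.choose.1.2 h.choose.2) else mk .bot
  Gam c := mk (.const c)

/-- `mk` is a quotient map for the identity `≡` that is given by `Φ`, and `out` is a section. -/
structure IsQuotientMap (s : Sys) (Φ : Set (Fm K)) (mk : Fm K → M) (out : M → Fm K) : Prop where
  mk_out : ∀ a, mk (out a) = a
  mk_eq_mk : ∀ {φ ψ : Fm K}, mk φ = mk ψ ↔ Derives s Φ (.eqv φ ψ)

namespace IsQuotientMap

local notation "D" => canonicalDomain s Φ mk out

theorem canonicalDomain_nec_subset : (D).NEC ⊆ (D).TRUE := fun _ ha => .mp ha (.ax (.T _))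

section

variable (hm : IsQuotientMap s Φ mk out)

include hm

theorem mk_eq_of_alpha {φ ψ : Fm K} (h : Fm.Alpha φ ψ) : mk φ = mk ψ :=
  hm.mk_eq_mk.2 (.eqv_of_alpha h)

theorem eqv_out (φ : Fm K) : Derives s Φ (.eqv (out (mk φ)) φ) :=
  hm.mk_eq_mk.1 (hm.mk_out _)

theorem mem_true {φ : Fm K} : mk φ ∈ (D).TRUE ↔ Derives s Φ φ :=
  ⟨fun h => (hm.eqv_out φ).of_eqv h, fun h => (hm.eqv_out φ).eqv_symm.of_eqv h⟩

theorem mem_nec {φ : Fm K} : mk φ ∈ (D).NEC ↔ Derives s Φ (.box φ) :=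
  ⟨fun h => (hm.eqv_out φ).eqv_box.of_eqv h, fun h => (hm.eqv_out φ).eqv_box.eqv_symm.of_eqv h⟩

theorem fbox_mk (φ : Fm K) : (D).fbox (mk φ) = mk (.box φ) :=
  hm.mk_eq_mk.2 (hm.eqv_out φ).eqv_box

theorem fneg_mk (φ : Fm K) : (D).fneg (mk φ) = mk (.neg φ) :=
  hm.mk_eq_mk.2 (hm.eqv_out φ).eqv_neg

theorem fdisj_mk (φ ψ : Fm K) : (D).fdisj (mk φ) (mk ψ) = mk (.or φ ψ) :=
  hm.mk_eq_mk.2 (.eqv_congr₂ .or (fun _ _ _ h => Finset.mem_union.2 h) (fun _ _ _ _ => rfl) .or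
    (hm.eqv_out φ) (hm.eqv_out ψ))

theorem fconj_mk (φ ψ : Fm K) : (D).fconj (mk φ) (mk ψ) = mk (.and φ ψ) :=
  hm.mk_eq_mk.2 (.eqv_congr₂ .and (fun _ _ _ h => Finset.mem_union.2 h) (fun _ _ _ _ => rfl) .and
    (hm.eqv_out φ) (hm.eqv_out ψ))

theorem fimp_mk (φ ψ : Fm K) : (D).fimp (mk φ) (mk ψ) = mk (.imp φ ψ) :=
  hm.mk_eq_mk.2 (.eqv_congr₂ .imp (fun _ _ _ h => Finset.mem_union.2 h) (fun _ _ _ _ => rfl) .imp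
    (hm.eqv_out φ) (hm.eqv_out ψ))

theorem feqv_mk (φ ψ : Fm K) : (D).feqv (mk φ) (mk ψ) = mk (.eqv φ ψ) :=
  hm.mk_eq_mk.2 (.eqv_congr₂ .eqv (fun _ _ _ h => Finset.mem_union.2 h) (fun _ _ _ _ => rfl) .eqv
    (hm.eqv_out φ) (hm.eqv_out ψ))

theorem le_mk {φ ψ : Fm K} : (D).le (mk φ) (mk ψ) ↔ Derives s Φ (.box (.imp φ ψ)) := by
  rw [PropDomain.le, hm.fimp_mk, hm.mem_nec]

theorem forall_iff {P : M → Prop} : (∀ a, P a) ↔ ∀ φ, P (mk φ) :=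
  ⟨fun h _ => h _, fun h a => hm.mk_out a ▸ h _⟩

/-- This is the well-definedness of `fall`. Both formulas are first renamed to a common variable
`w`; their instances at a constant `c` then both have the class `t (mk c)`, so the Henkin property
and `allEqv` apply. -/
theorem eqv_all_of_represents (hΦ : IsHenkin s Φ) {z z' : ℕ} {χ χ' : Fm K} {t : M → M}
    (h : Represents mk z χ t) (h' : Represents mk z' χ' t) :
    Derives s Φ (.eqv (.all z χ h.1) (.all z' χ' h'.1)) := by
  obtain ⟨w, hw⟩ := Infinite.exists_notMem_finset (χ.fvar ∪ χ'.fvar)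
  simp only [Finset.mem_union, not_or] at hw
  have hmem : ∀ {z} {χ : Fm K}, z ∈ χ.fvar → w ∈ (χ.subst₁ z (Fm.var w)).fvar := by
    intro z χ hz
    rw [Fm.subst₁_eq_gs]
    exact Fm.mem_fvar_gs_setVar hz _ _
  have hα := Fm.Alpha.rename h.1 (fun h => hw.1 (Fm.mem_fvar_all.1 h).2) (hmem h.1)
  have hα' := Fm.Alpha.rename h'.1 (fun h => hw.2 (Fm.mem_fvar_all.1 h).2) (hmem h'.1)
  refine .of_alpha (.eqv hα.symm hα'.symm)
    (.mp ((hΦ.henkin w (.eqv (χ.subst₁ z (.var w)) (χ'.subst₁ z' (.var w)))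
      (Fm.mem_fvar_eqv.2 (.inl (hmem h.1)))).2 fun c _ => ?_) (.ax (.allEqv _ _ _)))
  rw [Fm.subst₁_eqv, Fm.subst₁_subst₁ hw.1, Fm.subst₁_subst₁ hw.2, ← hm.mk_eq_mk, ← h.2, ← h'.2]

theorem fall_eq (hΦ : IsHenkin s Φ) {z : ℕ} {χ : Fm K} {t : M → M} (h : Represents mk z χ t) :
    (D).fall t = mk (.all z χ h.1) := by
  have hex : ∃ a : {p : ℕ × Fm K // p.1 ∈ p.2.fvar}, Represents mk a.1.1 a.1.2 t :=
    ⟨⟨(z, χ), h.1⟩, h⟩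
  refine (dif_pos hex).trans ?_
  exact hm.mk_eq_mk.2 (hm.eqv_all_of_represents hΦ hex.choose_spec h)

theorem update_mk (ρ : ℕ ⊕ K → Fm K) (x : ℕ) (ψ : Fm K) :
    Function.update (fun y => mk (ρ (.inl y))) x (mk ψ) =
      fun y => mk (setVar (fun p => (ρ p).gs Fm.ids) x ψ (.inl y)) := by
  funext y
  by_cases hy : y = x
  · subst hy; simp
  · rw [Function.update_of_ne hy, setVar_of_ne _ _ _ (by simpa using hy)]
    exact hm.mk_eq_of_alpha (.gs_ids _)

/-- The truth lemma. In the quantifier case, the induction hypothesis at all modified `ρ` says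
precisely that the renamed body represents the function to which `fall` is applied. -/
theorem eval_mk (hΦ : IsHenkin s Φ) (φ : Fm K) : ∀ {ρ : ℕ ⊕ K → Fm K},
    (∀ k, ρ (.inr k) = .const k) →
    (D).eval (fun y => mk (ρ (.inl y))) φ = mk (φ.gs ρ) := by
  induction φ using Fm.induct with
  | hvar x => intro ρ _; rfl
  | hconst c => intro ρ hρ; rw [Fm.gs_const, hρ]; rfl
  | hbot => intros; rfl
  | htop => intros; rfl
  | hneg φ ih => intro ρ hρ; exact (congrArg (D).fneg (ih hρ)).trans (hm.fneg_mk _)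
  | hbox φ ih => intro ρ hρ; exact (congrArg (D).fbox (ih hρ)).trans (hm.fbox_mk _)
  | himp φ ψ ih1 ih2 =>
    intro ρ hρ; exact (congrArg₂ (D).fimp (ih1 hρ) (ih2 hρ)).trans (hm.fimp_mk _ _)
  | hor φ ψ ih1 ih2 =>
    intro ρ hρ; exact (congrArg₂ (D).fdisj (ih1 hρ) (ih2 hρ)).trans (hm.fdisj_mk _ _)
  | hand φ ψ ih1 ih2 =>
    intro ρ hρ; exact (congrArg₂ (D).fconj (ih1 hρ) (ih2 hρ)).trans (hm.fconj_mk _ _)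
  | heqv φ ψ ih1 ih2 =>
    intro ρ hρ; exact (congrArg₂ (D).feqv (ih1 hρ) (ih2 hρ)).trans (hm.feqv_mk _ _)
  | hall x φ hx ih =>
    intro ρ hρ
    rw [Fm.gs_all]
    refine hm.fall_eq hΦ ⟨Fm.mem_fvar_gs_setVar hx _ _, fun ψ => ?_⟩
    rw [Fm.gs_setVar_subst₁ fun p hp hpx => Fm.freshFor_notMem (Fm.mem_ob_all.2 ⟨hpx, hp⟩),
      hm.update_mk]
    exact ih fun k => by rw [setVar_inr, hρ]; rfl

/-- The parameters supplied by `γ` are replaced by representatives of their classes. The variable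
`z` is left open, so that two functions can be represented in the same variable. -/
theorem represents_of_definableBy (hΦ : IsHenkin s Φ) {φ : Fm K} {x z : ℕ} {γ : ℕ → M} {t : M → M}
    (ht : (D).DefinableBy φ x γ t)
    (hz : ∀ p ∈ φ.ob, p ≠ .inl x → z ∉ (Sum.elim (fun y => out (γ y)) Fm.const p : Fm K).fvar) :
    Represents mk z (φ.gs (setVar (Sum.elim (fun y => out (γ y)) Fm.const) x (.var z))) t := by
  refine ⟨Fm.mem_fvar_gs_setVar ht.1 _ _, fun ψ => ?_⟩
  have hγ : γ = fun y => mk ((Sum.elim (fun y => out (γ y)) Fm.const : ℕ ⊕ K → Fm K) (.inl y)) :=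
    funext fun y => (hm.mk_out _).symm
  rw [Fm.gs_setVar_subst₁ hz, ht.2, ← hm.eval_mk hΦ φ (fun k => rfl), ← hm.update_mk, ← hγ]

theorem exists_represents₂ (hΦ : IsHenkin s Φ) {φ ψ : Fm K} {x : ℕ} {γ : ℕ → M} {t t' : M → M}
    (ht : (D).DefinableBy φ x γ t) (ht' : (D).DefinableBy ψ x γ t') :
    ∃ z χ χ', Represents mk z χ t ∧ Represents mk z χ' t' := by
  -- The implication serves only to obtain one variable that is fresh for the parameters of both
  -- formulas.
  have hx : x ∈ (Fm.imp φ ψ).fvar := Fm.mem_fvar_imp.2 (.inl ht.1)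
  exact ⟨Fm.freshFor (Sum.elim (fun y => out (γ y)) Fm.const) (Fm.all x (Fm.imp φ ψ) hx).ob, _, _,
    hm.represents_of_definableBy hΦ ht fun p hp hpx =>
      Fm.freshFor_notMem (Fm.mem_ob_all.2 ⟨hpx, Fm.mem_ob_imp.2 (.inl hp)⟩),
    hm.represents_of_definableBy hΦ ht' fun p hp hpx =>
      Fm.freshFor_notMem (Fm.mem_ob_all.2 ⟨hpx, Fm.mem_ob_imp.2 (.inr hp)⟩)⟩

theorem exists_represents (hΦ : IsHenkin s Φ) {t : M → M} (ht : (D).Definable t) :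
    ∃ z χ, Represents mk z χ t := by
  obtain ⟨φ, x, γ, ht⟩ := ht
  obtain ⟨z, χ, _, h, _⟩ := hm.exists_represents₂ hΦ ht ht
  exact ⟨z, χ, h⟩

theorem exists_represents_right (hΦ : IsHenkin s Φ) {φ ψ : Fm K} {x : ℕ} {γ : ℕ → M} {t : M → M}
    (hφ : x ∉ φ.fvar) (ht : (D).DefinableBy ψ x γ t) :
    ∃ z χ χ', z ∉ χ.fvar ∧ (D).eval γ φ = mk χ ∧ Represents mk z χ' t := by
  have hx : x ∈ (Fm.imp φ ψ).fvar := Fm.mem_fvar_imp.2 (.inr ht.1)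
  refine ⟨Fm.freshFor (Sum.elim (fun y => out (γ y)) Fm.const) (Fm.all x (Fm.imp φ ψ) hx).ob,
    φ.gs (Sum.elim (fun y => out (γ y)) Fm.const), _, ?_, ?_,
    hm.represents_of_definableBy hΦ ht fun p hp hpx =>
      Fm.freshFor_notMem (Fm.mem_ob_all.2 ⟨hpx, Fm.mem_ob_imp.2 (.inr hp)⟩)⟩
  · rw [Fm.mem_fvar_gs]
    rintro ⟨p, hp, h⟩
    refine Fm.freshFor_notMem (Fm.mem_ob_all.2 ⟨?_, Fm.mem_ob_imp.2 (.inl hp)⟩) h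
    rintro rfl
    exact hφ ((Fm.inl_mem_ob _).1 hp)
  · rw [← hm.eval_mk hΦ φ fun k => rfl]
    simp only [Sum.elim_inl, hm.mk_out]

theorem represents_feqv {z : ℕ} {χ χ' : Fm K} {t t' : M → M} (h : Represents mk z χ t)
    (h' : Represents mk z χ' t') :
    Represents mk z (.eqv χ χ') fun a => (D).feqv (t a) (t' a) :=
  ⟨Fm.mem_fvar_eqv.2 (.inl h.1), fun ψ => by simp only [h.2, h'.2, hm.feqv_mk]; rfl⟩

theorem represents_fimp {z : ℕ} {χ χ' : Fm K} {t t' : M → M} (h : Represents mk z χ t)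
    (h' : Represents mk z χ' t') :
    Represents mk z (.imp χ χ') fun a => (D).fimp (t a) (t' a) :=
  ⟨Fm.mem_fvar_imp.2 (.inl h.1), fun ψ => by simp only [h.2, h'.2, hm.fimp_mk]; rfl⟩

theorem represents_fimp_right {z : ℕ} {χ χ' : Fm K} {t : M → M} (h : z ∉ χ.fvar)
    (h' : Represents mk z χ' t) :
    Represents mk z (.imp χ χ') fun a => (D).fimp (mk χ) (t a) :=
  ⟨Fm.mem_fvar_imp.2 (.inr h'.1), fun ψ => by
    simp only [h'.2]
    rw [Fm.subst₁_imp, Fm.subst₁_of_notMem h, ← hm.fimp_mk,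
      hm.mk_eq_of_alpha (.gs_ids χ)]⟩

theorem represents_fbox {z : ℕ} {χ : Fm K} {t : M → M} (h : Represents mk z χ t) :
    Represents mk z (.box χ) fun a => (D).fbox (t a) :=
  ⟨h.1, fun ψ => by simp only [h.2, hm.fbox_mk]; rfl⟩

/-- On classes, `le` is provable strict implication, so every law is a necessitated tautology, and
every closure rule is one followed by distribution of `□`. -/
theorem isBooleanPrealgebra :
    IsBooleanPrealgebra (D).fbot (D).ftop (D).fneg (D).fdisj (D).fconj (D).fimp (D).le := by
  have hbot : (D).fbot = mk .bot := rfl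
  have htop : (D).ftop = mk .top := rfl
  apply IsBooleanPrealgebra.of_le <;>
    simp only [hm.forall_iff, hbot, htop, hm.fneg_mk, hm.fdisj_mk, hm.fconj_mk, hm.fimp_mk, hm.le_mk]
  · intro a
    exact .box_taut (p := .imp (.var 0) (.var 0)) (fun _ h => h) a a a
  · intro a b c h h'
    exact .box_mp h' (.box_mp h (.box_taut (p := .imp (.imp (.var 0) (.var 1))
      (.imp (.imp (.var 1) (.var 2)) (.imp (.var 0) (.var 2)))) (fun _ h h' h0 => h' (h h0)) a b c))
  · intro a
    exact .box_taut (p := .imp .bot (.var 0)) (fun _ h => h.elim) a a a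
  · intro a
    exact .box_taut (p := .imp (.var 0) .top) (fun _ _ => trivial) a a a
  · intro a b
    exact .box_taut (p := .imp (.var 0) (.or (.var 0) (.var 1))) (fun _ h => .inl h) a b b
  · intro a b
    exact .box_taut (p := .imp (.var 1) (.or (.var 0) (.var 1))) (fun _ h => .inr h) a b b
  · intro a b c h h'
    exact .box_mp h' (.box_mp h (.box_taut (p := .imp (.imp (.var 0) (.var 2))
      (.imp (.imp (.var 1) (.var 2)) (.imp (.or (.var 0) (.var 1)) (.var 2))))
      (fun _ h h' h0 => h0.elim h h') a b c))
  · intro a b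
    exact .box_taut (p := .imp (.and (.var 0) (.var 1)) (.var 0)) (fun _ h => h.1) a b b
  · intro a b
    exact .box_taut (p := .imp (.and (.var 0) (.var 1)) (.var 1)) (fun _ h => h.2) a b b
  · intro a b c h h'
    exact .box_mp h' (.box_mp h (.box_taut (p := .imp (.imp (.var 0) (.var 1))
      (.imp (.imp (.var 0) (.var 2)) (.imp (.var 0) (.and (.var 1) (.var 2)))))
      (fun _ h h' h0 => ⟨h h0, h' h0⟩) a b c))
  · intro a b c
    exact .box_taut (p := .imp (.and (.or (.var 0) (.var 1)) (.or (.var 0) (.var 2)))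
      (.or (.var 0) (.and (.var 1) (.var 2)))) (fun _ h => or_and_left.2 h) a b c
  · intro a b h
    exact .box_mp h (.box_taut (p := .imp (.imp (.var 0) (.var 1))
      (.imp (.neg (.var 1)) (.neg (.var 0)))) (fun _ h h1 h0 => h1 (h h0)) a b b)
  · intro a
    exact .box_taut (p := .imp (.and (.var 0) (.neg (.var 0))) .bot) (fun _ h => h.2 h.1) a a a
  · intro a
    exact .box_taut (p := .imp .top (.or (.var 0) (.neg (.var 0)))) (fun _ _ => em _) a a a
  · intro a b
    exact .box_taut (p := .imp (.imp (.var 0) (.var 1)) (.or (.var 1) (.neg (.var 0))))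
      (fun _ h => or_iff_not_imp_right.2 fun h0 => h (not_not.1 h0)) a b b
  · intro a b
    exact .box_taut (p := .imp (.or (.var 1) (.neg (.var 0))) (.imp (.var 0) (.var 1)))
      (fun _ h h0 => h.resolve_right fun h1 => h1 h0) a b b

theorem truthConditions (hΦ : IsHenkin s Φ) : (D).TruthConditions where
  bot := fun h => hΦ.consistent (hm.mem_true.1 h)
  top := hm.mem_true.2 (.taut (p := .top) (fun _ => trivial) .bot .bot .bot)
  imp := by
    simp only [hm.forall_iff, hm.fimp_mk, hm.mem_true]
    exact fun _ _ => hΦ.derives_imp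
  neg := by
    simp only [hm.forall_iff, hm.fneg_mk, hm.mem_true]
    exact fun _ => hΦ.derives_neg
  and := by
    simp only [hm.forall_iff, hm.fconj_mk, hm.mem_true]
    exact fun _ _ => IsHenkin.derives_and
  or := by
    simp only [hm.forall_iff, hm.fdisj_mk, hm.mem_true]
    exact fun _ _ => hΦ.derives_or
  box := by
    simp only [hm.forall_iff, hm.fbox_mk, hm.mem_true, hm.mem_nec, implies_true]
  eqv := by
    simp only [hm.forall_iff, hm.feqv_mk, hm.mem_true, hm.mk_eq_mk, implies_true]
  all t ht h := by
    obtain ⟨z, χ, hχ⟩ := hm.exists_represents hΦ ht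
    rw [hm.fall_eq hΦ hχ, hm.mem_true, hΦ.henkin]
    intro c _
    rw [← hm.mem_true, ← hχ.2]
    exact h _

theorem orderConditions (hΦ : IsHenkin s Φ) : (D).OrderConditions where
  eqv_refl := by
    have htop : (D).ftop = mk .top := rfl
    simp only [hm.forall_iff, htop, hm.feqv_mk, hm.le_mk]
    intro φ
    exact .box_mp (.an (.alpha (.refl φ)))
      (.box_taut (p := .imp (.var 0) (.imp .top (.var 0))) (fun _ h _ => h) (.eqv φ φ) φ φ)
  eqv_imp := by
    simp only [hm.forall_iff, hm.feqv_mk, hm.fimp_mk, hm.le_mk]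
    exact fun φ ψ => .an (.eqvImp φ ψ)
  eqv_subst := by
    simp only [hm.forall_iff]
    intro φ ψ t ht
    obtain ⟨z, χ, hχ⟩ := hm.exists_represents hΦ ht
    simp only [hχ.2, hm.feqv_mk, hm.le_mk]
    exact .an (.eqvSubst hχ.1 φ ψ)
  box_le := by
    simp only [hm.forall_iff, hm.fbox_mk, hm.le_mk]
    exact fun φ => .an (.T φ)
  box_imp := by
    simp only [hm.forall_iff, hm.fbox_mk, hm.fimp_mk, hm.le_mk]
    exact fun φ ψ => .an (.distr φ ψ)
  box_imp_box := by
    simp only [hm.forall_iff, hm.fbox_mk, hm.fimp_mk, hm.le_mk]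
    exact fun φ ψ => .an (.distrBox φ ψ)
  all_eqv φ ψ x γ t t' ht ht' := by
    obtain ⟨z, χ, χ', h, h'⟩ := hm.exists_represents₂ hΦ ht ht'
    rw [hm.fall_eq hΦ h, hm.fall_eq hΦ h', hm.fall_eq hΦ (hm.represents_feqv h h'), hm.feqv_mk,
      hm.le_mk]
    exact .an (.allEqv _ _ _)
  all_le := by
    simp only [hm.forall_iff]
    intro t ht φ
    obtain ⟨z, χ, h⟩ := hm.exists_represents hΦ ht
    rw [hm.fall_eq hΦ h, h.2, hm.le_mk]
    exact .an (.allInst _ _)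
  all_imp φ ψ x γ t t' ht ht' := by
    obtain ⟨z, χ, χ', h, h'⟩ := hm.exists_represents₂ hΦ ht ht'
    rw [hm.fall_eq hΦ h, hm.fall_eq hΦ h', hm.fall_eq hΦ (hm.represents_fimp h h'), hm.fimp_mk,
      hm.le_mk]
    exact .an (.allImp _ _ _)
  all_imp_right φ ψ x γ t hφ ht := by
    obtain ⟨z, χ, χ', hz, he, h⟩ := hm.exists_represents_right hΦ hφ ht
    rw [he, hm.fall_eq hΦ h, hm.fall_eq hΦ (hm.represents_fimp_right hz h), hm.fimp_mk, hm.le_mk]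
    exact .an (.allImpRight _ hz _)
  box_all t ht := by
    obtain ⟨z, χ, h⟩ := hm.exists_represents hΦ ht
    rw [hm.fall_eq hΦ h, hm.fall_eq hΦ (hm.represents_fbox h), hm.fbox_mk, hm.le_mk, hm.le_mk]
    exact ⟨.an (.barcanConv _ _), .an (.barcan _ _)⟩
  all_nec t ht hnec := by
    obtain ⟨z, χ, h⟩ := hm.exists_represents hΦ ht
    rw [hm.fall_eq hΦ h, hm.mem_nec]
    -- The Henkin property yields `∀ z □χ`, and the Barcan formula moves the box outside.
    refine .mp ((hΦ.henkin z (.box χ) h.1).2 fun c _ => ?_) (.ax (.barcan h.1 h.1))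
    rw [Fm.subst₁_box, ← hm.mem_nec, ← h.2]
    exact hnec _

theorem nec_nonempty : (D).NEC.Nonempty :=
  ⟨mk .top, hm.mem_nec.2 (.box_taut (p := .top) (fun _ => trivial) .bot .bot .bot)⟩

theorem nec_filter (hΦ : IsHenkin s Φ) : IsPreFilter (D).fbot (D).fconj (D).le (D).NEC where
  nonempty := hm.nec_nonempty
  up := by
    simp only [hm.forall_iff, hm.mem_nec, hm.le_mk]
    exact fun _ _ h h' => h.box_mp h'
  and_mem := by
    simp only [hm.forall_iff, hm.mem_nec, hm.fconj_mk]
    intro φ ψ h h'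
    exact .box_mp h' (.box_mp h (.box_taut
      (p := .imp (.var 0) (.imp (.var 1) (.and (.var 0) (.var 1)))) (fun _ h h' => ⟨h, h'⟩) φ ψ ψ))
  bot_notMem := fun h => (hm.truthConditions hΦ).bot (canonicalDomain_nec_subset h)

theorem isNormalModel (hΦ : IsHenkin s Φ) : (D).IsNormalModel s := by
  have h3 : (D).IsS3Model ∧ (D).NEC.Nonempty :=
    ⟨⟨fun _ => hm.isBooleanPrealgebra, hm.truthConditions hΦ, fun _ => canonicalDomain_nec_subset,
      fun _ => hm.nec_filter hΦ, fun _ => hm.orderConditions hΦ⟩, hm.nec_nonempty⟩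
  have h4 : s = .S4 ∨ s = .S5 → ∀ a, (D).le ((D).fbox a) ((D).fbox ((D).fbox a)) := by
    intro hs
    simp only [hm.forall_iff, hm.fbox_mk, hm.le_mk]
    exact fun φ => .an (.four hs φ)
  have h5 : s = .S5 → ∀ a, (D).le ((D).fneg ((D).fbox a)) ((D).fbox ((D).fneg ((D).fbox a))) := by
    intro hs
    simp only [hm.forall_iff, hm.fbox_mk, hm.fneg_mk, hm.le_mk]
    exact fun φ => .an (.five hs φ)
  cases s
  · exact h3
  · exact ⟨h3, h4 (.inl rfl)⟩
  · exact ⟨⟨h3, h4 (.inr rfl)⟩, h5 rfl⟩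

theorem sat_iff (hΦ : IsHenkin s Φ) (φ : Fm K) :
    (D).Sat (fun x => mk (.var x)) φ ↔ Derives s Φ φ := by
  rw [PropDomain.Sat, ← hm.mem_true]
  have := hm.eval_mk hΦ φ (ρ := Fm.ids) fun k => rfl
  rw [hm.mk_eq_of_alpha (.gs_ids φ), ← this]
  rfl

end

end IsQuotientMap

/-- The setoid of the identity `≡` given by `Φ`. -/
def eqvSetoid (s : Sys) (Φ : Set (Fm K)) : Setoid (Fm K) where
  r φ ψ := Derives s Φ (.eqv φ ψ)
  iseqv := ⟨fun φ => .eqv_of_alpha (.refl φ), fun h => h.eqv_symm, fun h h' => h.eqv_trans h'⟩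

theorem IsHenkin.hasNormalModel (hΦ : IsHenkin s Φ) : HasNormalModel.{u, v} s Φ := by
  -- The quotient lives in the universe of the constants and is lifted to the universe required of
  -- models.
  have hm : IsQuotientMap s Φ (fun φ => ULift.up.{v} (Quotient.mk (eqvSetoid s Φ) φ))
      fun a => Quotient.out a.down :=
    ⟨fun a => ULift.ext _ _ (Quotient.out_eq _),
      fun {φ ψ} => ULift.up_inj.trans (Quotient.eq (r := eqvSetoid s Φ))⟩
  exact ⟨_, _, hm.isNormalModel hΦ, _, fun ψ hψ => (hm.sat_iff hΦ ψ).2 (.hyp hψ)⟩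

end Canonical

end NFL

namespace NFL

/-! ## Extending consistent sets to Henkin sets -/

section Consistent

variable {K : Type u} {s : Sys}

theorem Derives.exists_of_sUnion {C : Set (Set (Fm K))} (hC : IsChain (· ⊆ ·) C)
    (hne : C.Nonempty) {φ : Fm K} (h : Derives s (⋃₀ C) φ) : ∃ Φ ∈ C, Derives s Φ φ := by
  induction h with
  | hyp h => obtain ⟨Φ, hΦ, h⟩ := h; exact ⟨Φ, hΦ, .hyp h⟩
  | ax h => obtain ⟨Φ, hΦ⟩ := hne; exact ⟨Φ, hΦ, .ax h⟩
  | an h => obtain ⟨Φ, hΦ⟩ := hne; exact ⟨Φ, hΦ, .an h⟩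
  | mp _ _ ih1 ih2 =>
    obtain ⟨Φ, hΦ, h⟩ := ih1
    obtain ⟨Ψ, hΨ, h'⟩ := ih2
    rcases hC.total hΦ hΨ with hle | hle
    · exact ⟨Ψ, hΨ, .mp (h.mono hle) h'⟩
    · exact ⟨Φ, hΦ, .mp h (h'.mono hle)⟩

/-- Every consistent set is contained in a maximally consistent one. -/
theorem Consistent.exists_maximal {Φ : Set (Fm K)} (hΦ : Consistent s Φ) :
    ∃ Ψ, Φ ⊆ Ψ ∧ Consistent s Ψ ∧ ∀ X, Consistent s X → Ψ ⊆ X → X = Ψ := by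
  obtain ⟨Ψ, hle, hΨ⟩ := zorn_subset_nonempty {Ψ | Consistent s Ψ} (fun C hC hchain hne =>
    ⟨⋃₀ C, fun h => by
      obtain ⟨X, hX, h⟩ := Derives.exists_of_sUnion hchain hne h
      exact hC hX h, fun X hX => Set.subset_sUnion_of_mem hX⟩) Φ hΦ
  exact ⟨Ψ, hle, hΨ.prop, fun X hX h => (hΨ.eq_of_subset hX h).symm⟩

end Consistent

/-! ### Reducts of models to a smaller language -/

/-- The substitution that renames the constants by `f`. -/
def mapConst {K : Type u} {L : Type v} (f : K → L) : ℕ ⊕ K → Fm L :=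
  Sum.elim Fm.var fun k => Fm.const (f k)

namespace PropDomain

variable {K : Type u} {L : Type v} {M : Type w} {D : PropDomain L M} {s : Sys} (f : K → L)

theorem eval_withGam (γ : ℕ → M) (φ : Fm K) :
    (D.withGam fun k => D.Gam (f k)).eval γ φ = D.eval γ (φ.gs (mapConst f)) :=
  (D.eval_gs φ (mapConst f) γ).symm

theorem mem_fvar_gs_mapConst {φ : Fm K} {x : ℕ} : x ∈ (φ.gs (mapConst f)).fvar ↔ x ∈ φ.fvar := by
  rw [Fm.mem_fvar_gs]
  constructor
  · rintro ⟨p | k, hp, h⟩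
    · obtain rfl := Fm.mem_fvar_var.1 h
      exact (Fm.inl_mem_ob _).1 hp
    · exact absurd h (Finset.notMem_empty _)
  · intro h
    exact ⟨.inl x, (Fm.inl_mem_ob _).2 h, Fm.mem_fvar_var.2 rfl⟩

variable {f}

/-- A function definable in the reduct is definable in `D` by the translated formula, so the reduct
has to meet no condition that `D` does not already meet. -/
theorem DefinableBy.of_withGam {φ : Fm K} {x : ℕ} {γ : ℕ → M} {t : M → M}
    (h : (D.withGam fun k => D.Gam (f k)).DefinableBy φ x γ t) :
    D.DefinableBy (φ.gs (mapConst f)) x γ t :=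
  ⟨(mem_fvar_gs_mapConst f).2 h.1, fun m => (h.2 m).trans (eval_withGam f _ φ)⟩

theorem Definable.of_withGam {t : M → M}
    (h : (D.withGam fun k => D.Gam (f k)).Definable t) : D.Definable t := by
  obtain ⟨φ, x, γ, h⟩ := h
  exact ⟨_, x, γ, h.of_withGam⟩

theorem IsS3Model.withGam (h : D.IsS3Model) : (D.withGam fun k => D.Gam (f k)).IsS3Model where
  prealgebra := h.prealgebra
  truth :=
    { bot := h.truth.bot
      top := h.truth.top
      imp := h.truth.imp
      neg := h.truth.neg
      and := h.truth.and
      or := h.truth.or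
      box := h.truth.box
      eqv := h.truth.eqv
      all := fun t ht => h.truth.all t ht.of_withGam }
  nec_subset := h.nec_subset
  nec_filter := h.nec_filter
  order := fun hne =>
    { eqv_refl := (h.order hne).eqv_refl
      eqv_imp := (h.order hne).eqv_imp
      eqv_subst := fun a b t ht => (h.order hne).eqv_subst a b t ht.of_withGam
      box_le := (h.order hne).box_le
      box_imp := (h.order hne).box_imp
      box_imp_box := (h.order hne).box_imp_box
      all_eqv := fun _ _ x γ t t' ht ht' =>
        (h.order hne).all_eqv _ _ x γ t t' ht.of_withGam ht'.of_withGam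
      all_le := fun t ht => (h.order hne).all_le t ht.of_withGam
      all_imp := fun _ _ x γ t t' ht ht' =>
        (h.order hne).all_imp _ _ x γ t t' ht.of_withGam ht'.of_withGam
      all_imp_right := fun φ _ x γ t hφ ht => by
        rw [eval_withGam]
        exact (h.order hne).all_imp_right _ _ x γ t (fun h => hφ ((mem_fvar_gs_mapConst f).1 h))
          ht.of_withGam
      box_all := fun t ht => (h.order hne).box_all t ht.of_withGam
      all_nec := fun t ht => (h.order hne).all_nec t ht.of_withGam }

/-- The reduct of a normal model to a smaller language is a normal model. -/
theorem IsNormalModel.withGam (h : D.IsNormalModel s) :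
    (D.withGam fun k => D.Gam (f k)).IsNormalModel s := by
  cases s
  · exact ⟨h.1.withGam, h.2⟩
  · exact ⟨⟨h.1.1.withGam, h.1.2⟩, h.2⟩
  · exact ⟨⟨⟨h.1.1.1.withGam, h.1.1.2⟩, h.1.2⟩, h.2⟩

end PropDomain

theorem HasNormalModel.of_mapConst {K : Type u} {L : Type u} {s : Sys} {f : K → L}
    {Φ : Set (Fm K)} (h : HasNormalModel.{u, v} s ((fun φ => φ.gs (mapConst f)) '' Φ)) :
    HasNormalModel.{u, v} s Φ := by
  obtain ⟨M, D, hD, γ, h⟩ := h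
  refine ⟨M, _, hD.withGam (f := f), γ, fun ψ hψ => ?_⟩
  rw [PropDomain.Sat, PropDomain.eval_withGam]
  exact h _ ⟨ψ, hψ, rfl⟩

/-! ### Witnessing constants and the Henkin extension -/

/-- The constants of the language in which each `∀ x φ` has a witness, the constant `wit x φ`. -/
inductive HenkinConst (K : Type u) : Type u
  | base : K → HenkinConst K
  | wit : ℕ → PreFm (HenkinConst K) → HenkinConst K

namespace HenkinConst

variable {K : Type u}

theorem sizeOf_lt_of_mem_ob {L : Type u} [SizeOf L] {c : L} {φ : PreFm L} (h : .inr c ∈ φ.ob) :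
    sizeOf c < sizeOf φ := by
  induction φ with
  | var x | bot | top => simp [PreFm.ob] at h
  | const k => simp [PreFm.ob] at h; subst h; simp
  | neg φ ih | box φ ih => have := ih h; simp; omega
  | imp φ ψ ih1 ih2 | or φ ψ ih1 ih2 | and φ ψ ih1 ih2 | eqv φ ψ ih1 ih2 =>
    simp only [PreFm.ob, Finset.mem_union] at h
    rcases h with h | h
    · have := ih1 h; simp; omega
    · have := ih2 h; simp; omega
  | all x φ ih => have := ih (PreFm.mem_ob_all.1 h).2; simp; omega

/-- Size replaces the stage at which a witness would enter in a step-by-step construction of the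
language. -/
theorem sizeOf_lt_wit {c : HenkinConst K} {x : ℕ} {φ : PreFm (HenkinConst K)}
    (h : .inr c ∈ φ.ob) : sizeOf c < sizeOf (wit x φ) := by
  have := sizeOf_lt_of_mem_ob h
  simp; omega

/-- The pairs `(x, φ)` such that `∀ x φ` is a formula. -/
abbrev Index (K : Type u) : Type u := {p : ℕ × Fm (HenkinConst K) // p.1 ∈ p.2.fvar}

/-- The witness of `∀ x φ`. -/
def witness (i : Index K) : HenkinConst K := wit i.1.1 i.1.2.1

/-- The formula `φ[x := c] → ∀ x φ`, where `c` is the witness of `∀ x φ`. -/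
def henkinAxiom (i : Index K) : Fm (HenkinConst K) :=
  .imp (i.1.2.subst₁ i.1.1 (.const (witness i))) (.all i.1.1 i.1.2 i.2)

theorem witness_injective : Function.Injective (witness (K := K)) := by
  rintro ⟨⟨x, φ⟩, h⟩ ⟨⟨y, ψ⟩, h'⟩ heq
  simp only [witness, wit.injEq] at heq
  obtain ⟨rfl, heq⟩ := heq
  obtain rfl := Subtype.ext heq
  rfl

theorem notMem_ob_gs_base (i : Index K) (φ : Fm K) : .inr (witness i) ∉ (φ.gs (mapConst base)).ob := by
  rw [Fm.mem_ob_gs]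
  rintro ⟨p | k, -, h⟩
  · exact absurd (Fm.mem_ob_ids (p := .inl p).1 h) (by simp)
  · exact absurd (Fm.mem_ob_ids (p := .inr (base k)).1 h) (by simp [witness])

theorem notMem_ob_henkinAxiom {i j : Index K} (hij : i ≠ j)
    (hle : sizeOf (witness j) ≤ sizeOf (witness i)) : .inr (witness i) ∉ (henkinAxiom j).ob := by
  have hmem : .inr (witness i) ∉ j.1.2.ob := fun h => absurd (sizeOf_lt_wit (x := j.1.1) h)
    (not_lt.2 hle)
  intro h
  rcases Fm.mem_ob_imp.1 h with h | h
  · rw [Fm.subst₁_eq_gs, Fm.mem_ob_gs] at h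
    obtain ⟨p, hp, h⟩ := h
    by_cases hpx : p = .inl j.1.1
    · subst hpx
      rw [setVar_same] at h
      have := Fm.mem_ob_ids (p := .inr (witness j)).1 h
      exact hij (witness_injective (Sum.inr_injective this))
    · rw [setVar_of_ne _ _ _ hpx, Fm.mem_ob_ids] at h
      exact hmem (h ▸ hp)
  · exact hmem (Fm.mem_ob_all.1 h).2

variable {s : Sys}

theorem consistent_gs_base {Φ : Set (Fm K)} (hΦ : Consistent s Φ) :
    Consistent s ((fun φ => φ.gs (mapConst (base (K := K)))) '' Φ) := by
  intro h
  -- A derivation in the large language is translated back. No witness occurs in the premises or in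
  -- `⊥`, so collapsing the witnesses to `⊥` does no harm.
  let ρ : ℕ ⊕ HenkinConst K → Fm K := Sum.elim Fm.var fun
    | base k => Fm.const k
    | wit _ _ => Fm.bot
  have hρ : ∀ p, (ρ p).gs Fm.ids = ρ p := by
    rintro (x | k | ⟨x, φ⟩) <;> rfl
  refine hΦ (.trans ?_ (h.gs hρ))
  rintro _ ⟨_, ⟨φ, hφ, rfl⟩, rfl⟩
  have : (φ.gs (mapConst base)).gs ρ = φ.gs Fm.ids := by
    rw [Fm.gs_gs]
    refine Fm.gs_congr fun p _ => ?_
    rcases p with x | k <;> rfl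
  show Derives s Φ ((φ.gs (mapConst base)).gs ρ)
  rw [this]
  exact .of_alpha (.gs_ids φ) (.hyp hφ)

/-- The axioms are added by increasing size of the witness, so each new witness is absent from
everything before it. If the new axiom were refutable, `φ[x := c]` and `¬ ∀ x φ` would be derivable,
and generalization on `c` would contradict the latter. -/
theorem consistent_union_image {Φ : Set (Fm K)} (hΦ : Consistent s Φ) (S : Finset (Index K)) :
    Consistent s ((fun φ => φ.gs (mapConst (base (K := K)))) '' Φ ∪ henkinAxiom '' S) := by
  classical
  induction S using Finset.induction_on_max_value (fun i : Index K => sizeOf (witness i)) with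
  | empty => simpa using consistent_gs_base hΦ
  | insert i S hi hmax ih =>
    intro h
    rw [Finset.coe_insert, Set.image_insert_eq, Set.union_insert] at h
    have hneg := Derives.neg_of_imp_bot h.deduction
    refine ih (.bot_of_neg (.gen_const ?_ ?_ i.2 hneg.of_neg_imp_left) hneg.of_neg_imp_right)
    · rintro _ (⟨φ, -, rfl⟩ | ⟨j, hj, rfl⟩)
      · exact notMem_ob_gs_base i φ
      · exact notMem_ob_henkinAxiom (fun h => hi (h ▸ hj)) (hmax j hj)
    · exact fun h => lt_irrefl _ (sizeOf_lt_wit (x := i.1.1) h)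

theorem consistent_union_range {Φ : Set (Fm K)} (hΦ : Consistent s Φ) :
    Consistent s ((fun φ => φ.gs (mapConst (base (K := K)))) '' Φ ∪ Set.range henkinAxiom) := by
  intro h
  obtain ⟨F, hF, hFs, h⟩ := h.exists_finset
  obtain ⟨T, -, hT, hsub⟩ := Set.exists_subset_image_finite_and (f := henkinAxiom (K := K))
    (s := Set.univ) (p := fun T => F ∩ Set.range henkinAxiom ⊆ T) |>.1
    ⟨F ∩ Set.range henkinAxiom, by simp, hF.inter_of_left _, subset_rfl⟩
  refine consistent_union_image hΦ hT.toFinset (h.mono fun φ hφ => ?_)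
  rcases hFs hφ with h' | h'
  · exact .inl h'
  · exact .inr (by simpa using hsub ⟨hφ, h'⟩)

end HenkinConst

open HenkinConst in
theorem Consistent.exists_isHenkin {K : Type u} {s : Sys} {Φ : Set (Fm K)} (hΦ : Consistent s Φ) :
    ∃ Ψ : Set (Fm (HenkinConst K)), (fun φ => φ.gs (mapConst base)) '' Φ ⊆ Ψ ∧ IsHenkin s Ψ := by
  obtain ⟨Ψ, hle, hΨ, hmax⟩ := (consistent_union_range hΦ).exists_maximal
  refine ⟨Ψ, Set.subset_union_left.trans hle, hΨ, hmax, fun x φ hx => ⟨fun h c _ => ?_, fun h => ?_⟩⟩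
  · exact .mp h (.ax (.allInst hx c))
  -- The instance at the witness of `∀ x φ` suffices, by its Henkin axiom.
  · exact .mp (h _ (.inr (.inr ⟨_, rfl⟩))) (.hyp (hle (.inr ⟨⟨(x, φ), hx⟩, rfl⟩)))

theorem Consistent.hasNormalModel {K : Type u} {s : Sys} {Φ : Set (Fm K)} (hΦ : Consistent s Φ) :
    HasNormalModel.{u, v} s Φ := by
  obtain ⟨Ψ, hle, hΨ⟩ := hΦ.exists_isHenkin
  obtain ⟨M, D, hD, γ, h⟩ := hΨ.hasNormalModel.{u, v}
  exact .of_mapConst ⟨M, D, hD, γ, fun ψ hψ => h ψ (hle hψ)⟩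

theorem consequence_iff_derives {K : Type u} {s : Sys} {Φ : Set (Fm K)} {φ : Fm K} :
    Consequence.{u, v} s Φ φ ↔ Derives s Φ φ := by
  refine ⟨fun h => ?_, fun h M D hD γ hΦ => hD.sat_of_derives h hΦ⟩
  by_contra hφ
  have hcons : Consistent s (insert (.neg φ) Φ) := fun h' => hφ h'.deduction.of_neg_imp_bot
  obtain ⟨M, D, hD, γ, hsat⟩ := hcons.hasNormalModel.{u, v}
  exact (hD.isS3Model.truth.neg _).1 (hsat _ (Set.mem_insert _ _))
    (h M D hD γ fun ψ hψ => hsat ψ (Set.mem_insert_of_mem _ hψ))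

end NFL

theorem theorem660 {K : Type u} (s : NFL.Sys) :
    (∀ Φ : Set (NFL.Fm K), NFL.IsHenkin s Φ → NFL.HasNormalModel.{u, v} s Φ) ∧
    (∀ Φ : Set (NFL.Fm K), NFL.Consistent s Φ → NFL.HasNormalModel.{u, v} s Φ) ∧
    (∀ (Φ : Set (NFL.Fm K)) (φ : NFL.Fm K),
      NFL.Consequence.{u, v} s Φ φ ↔ NFL.Derives s Φ φ) :=
  ⟨fun _ h => h.hasNormalModel, fun _ h => h.hasNormalModel,
    fun _ _ => NFL.consequence_iff_derives⟩
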